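/- All graphs are finite and simple. Two vertices are \emph{joined by $c$ paths} of a graph if the graph contains $c$ distinct paths between them, any two of which have only their two ends in common. A graph is \emph{3-connected} if it has more than three vertices and deleting at most two vertices never disconnects it. There is an algorithm with the following specification. \emph{Input:} an integer $c\ge 1$, a graph $F=(V,E)$ given by its list of edges, and a partition of $V$ into a vertex cover $X$ of $F$ and a stable set $S$ of $F$. \emph{Output:} a subgraph $J$ of $F$ with $X\subseteq V(J)$ such that (i) $|V(J)|\le 2\,c!\,|X|$; (ii) for every vertex $v\in V(F)\setminus V(J)$, every two neighbours of $v$ in $F$ lie in $J$ and are joined by $c$ paths of $J$; (iii) if $c\ge 3$ and $F$ is 3-connected, then $J$ is 3-connected. \emph{Running time:} there is an absolute constant $C$ such that on every input the algorithm halts after at most $C\,c\,\max(1,\Delta_S)\,\max(1,|V|+|E|)$ steps, where $\Delta_S$ is the maximum degree in $F$ of a vertex of $S$ ($0$ if $S=\emptyset$). Here an algorithm is a program for a unit-cost random access machine with registers and arrays of natural numbers, whose instructions are assignment of constants, copying, successor, truncated subtraction, indirect reading and writing, comparison, and structured control flow. -/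

import Mathlib

open Nat

namespace SmallCover

/-! ### Connectivity -/

/-- `u` and `w` are joined by `c` paths of `G`: there are `c` distinct paths of `G` from `u` to `w`,
any two of which have only their ends `u`, `w` in common (internally vertex-disjoint paths). -/
def JoinedBy {V : Type*} (G : SimpleGraph V) (c : ℕ) (u w : V) : Prop :=
  ∃ P : Fin c → G.Path u w, Function.Injective P ∧
    ∀ i j, i ≠ j → ∀ x, x ∈ (P i : G.Walk u w).support → x ∈ (P j : G.Walk u w).support →
      x = u ∨ x = w

/-- A finite graph is `k`-connected if it has more than `k` vertices and deleting fewer than `k`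
vertices never disconnects it. -/
def IsKConnected {V : Type*} [Finite V] (G : SimpleGraph V) (k : ℕ) : Prop :=
  k < Nat.card V ∧ ∀ W : Set V, W.ncard < k → (G.induce Wᶜ).Connected

/-! ### The machine model

A random access machine at unit cost, with structured control flow. Its memory holds natural numbers
and consists of scalar registers and of arrays (a fixed program refers to finitely many of each).
The only arithmetic is successor and truncated subtraction, so that in `t` steps no number exceeds
the largest number in the input and the program by more than `t`: words of logarithmic length
suffice for a computation of polynomial length. -/

/-- Memory contents: `reg x` is the content of register `x`, and `arr a i` is the content of cell `i`
of array `a`. -/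
structure State where
  reg : ℕ → ℕ
  arr : ℕ → ℕ → ℕ

namespace State

/-- Write `k` to register `x`. -/
def setReg (s : State) (x k : ℕ) : State :=
  { s with reg := Function.update s.reg x k }

/-- Write `k` to cell `i` of array `a`. -/
def setArr (s : State) (a i k : ℕ) : State :=
  { s with arr := Function.update s.arr a (Function.update (s.arr a) i k) }

end State

/-- Tests of the machine: comparison of two registers. -/
inductive Test where
  | lt (x y : ℕ)
  | eq (x y : ℕ)

/-- When a test succeeds. -/
def Test.Holds : Test → State → Prop
  | .lt x y, s => s.reg x < s.reg y
  | .eq x y, s => s.reg x = s.reg y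

/-- Programs. The arguments `x y z` are register names, `a` is an array name, `k` a constant. -/
inductive Cmd where
  /-- do nothing -/
  | skip
  /-- `x := k` -/
  | const (x k : ℕ)
  /-- `x := y` -/
  | copy (x y : ℕ)
  /-- `x := y + 1` -/
  | succ (x y : ℕ)
  /-- `x := y - z` (and `0` if `y < z`) -/
  | sub (x y z : ℕ)
  /-- `x := a[y]` -/
  | load (x a y : ℕ)
  /-- `a[x] := y` -/
  | store (a x y : ℕ)
  /-- first `p`, then `q` -/
  | seq (p q : Cmd)
  /-- if `b` then `p` else `q` -/
  | ite (b : Test) (p q : Cmd)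
  /-- while `b` do `p` -/
  | while (b : Test) (p : Cmd)

/-- `Exec p s s' t`: the program `p`, started in the state `s`, halts in the state `s'` after exactly
`t` steps, where each elementary instruction and each evaluation of a test is one step. -/
inductive Exec : Cmd → State → State → ℕ → Prop where
  | skip (s : State) : Exec .skip s s 1
  | const (s : State) (x k : ℕ) : Exec (.const x k) s (s.setReg x k) 1
  | copy (s : State) (x y : ℕ) : Exec (.copy x y) s (s.setReg x (s.reg y)) 1
  | succ (s : State) (x y : ℕ) : Exec (.succ x y) s (s.setReg x (s.reg y + 1)) 1
  | sub (s : State) (x y z : ℕ) : Exec (.sub x y z) s (s.setReg x (s.reg y - s.reg z)) 1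
  | load (s : State) (x a y : ℕ) : Exec (.load x a y) s (s.setReg x (s.arr a (s.reg y))) 1
  | store (s : State) (a x y : ℕ) : Exec (.store a x y) s (s.setArr a (s.reg x) (s.reg y)) 1
  | seq {p q : Cmd} {s₁ s₂ s₃ : State} {t₁ t₂ : ℕ} :
      Exec p s₁ s₂ t₁ → Exec q s₂ s₃ t₂ → Exec (.seq p q) s₁ s₃ (t₁ + t₂)
  | ite_true {b : Test} {p q : Cmd} {s s' : State} {t : ℕ} :
      b.Holds s → Exec p s s' t → Exec (.ite b p q) s s' (1 + t)
  | ite_false {b : Test} {p q : Cmd} {s s' : State} {t : ℕ} :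
      ¬ b.Holds s → Exec q s s' t → Exec (.ite b p q) s s' (1 + t)
  | while_true {b : Test} {p : Cmd} {s₁ s₂ s₃ : State} {t₁ t₂ : ℕ} :
      b.Holds s₁ → Exec p s₁ s₂ t₁ → Exec (.while b p) s₂ s₃ t₂ →
        Exec (.while b p) s₁ s₃ (1 + t₁ + t₂)
  | while_false {b : Test} {p : Cmd} {s : State} :
      ¬ b.Holds s → Exec (.while b p) s s 1

/-! ### Input and output -/

/-- `e` lists every edge of `F` exactly once, in any order, and with its ends in any order.
In particular `m` is the number of edges of `F`. -/
def IsEdgeList {n m : ℕ} (F : SimpleGraph (Fin n)) (e : Fin m → Fin n × Fin n) : Prop :=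
  Function.Injective (fun j => s((e j).1, (e j).2)) ∧
    Set.range (fun j => s((e j).1, (e j).2)) = F.edgeSet

/-- The input state for an integer `c`, a graph with vertices `0, …, n - 1` and edge list `e`, and a
vertex set `X`. Registers `0, 1, 2` hold `n`, the number `m` of edges, and `c`; arrays `0` and `1`
hold the first and second ends of the edges; array `2` is the indicator of `X`. All other memory
is zero. -/
def inputState {n m : ℕ} (c : ℕ) (e : Fin m → Fin n × Fin n) (X : Finset (Fin n)) : State where
  reg x := match x with
    | 0 => n
    | 1 => m
    | 2 => c
    | _ => 0
  arr a i := match a with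
    | 0 => if h : i < m then ((e ⟨i, h⟩).1 : ℕ) else 0
    | 1 => if h : i < m then ((e ⟨i, h⟩).2 : ℕ) else 0
    | 2 => if ∃ h : i < n, (⟨i, h⟩ : Fin n) ∈ X then 1 else 0
    | _ => 0

open Classical in
/-- The state `s` contains the subgraph `J` as output: on the vertices, array `3` is the indicator of
`V(J)`; on the positions of the edge list `e`, array `4` is the indicator of `E(J)`. -/
def Outputs {n m : ℕ} {F : SimpleGraph (Fin n)} (s : State) (e : Fin m → Fin n × Fin n)
    (J : F.Subgraph) : Prop :=
  (∀ v : Fin n, s.arr 3 v = if v ∈ J.verts then 1 else 0) ∧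
    ∀ j : Fin m, s.arr 4 j = if s((e j).1, (e j).2) ∈ J.edgeSet then 1 else 0

end SmallCover

namespace SmallCover

/-! ### Menger's theorem for two non-adjacent vertices, from Hall's theorem -/

/-! A selected vertex outside `X`, with an ordered pair (x, y) of its neighbours, serves as a link
between x and y. The vertices of `X` are scanned one by one, always one with the greatest `r`, where
`r y` counts the scanned vertices linked with y. The scan of x visits each unselected neighbour v of
x outside `X` and selects v for a pair (x, y) if v has an unscanned neighbour y ≠ x with `r y < c`
and with fewer than `c` links to x. The subgraph `J` is induced by `X` and the selected vertices.

The greedy choice works as in maximum adjacency orderings: two unscanned vertices u, w stay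
connected through links and scanned vertices after the deletion of fewer than min(`r u`, `r w`)
other vertices (`Inv.conn`, preserved by `Scan.conn` and `Scan.finish`). If v is never selected and
x, y are two of its neighbours, x scanned first, then after the scan of x either `r y` has reached
`c` or x and y have `c` direct links; in both cases fewer than `c` vertices do not separate x from
y. Menger's theorem, obtained from Hall's theorem in `exists_linkage`, turns this into `c` paths.

Each selected vertex is charged to its second neighbour. By `Scan.select` no vertex is charged more
than c(c-1)+1 times, so `J` has at most (c(c-1)+2)|X| vertices. For 3-connectivity, a walk of `F` is
rerouted around the vertices outside `J`, whose neighbours cannot be separated in `J` by two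
vertices (`Inv.isKConnected_cover`).

The program keeps `X` in buckets by `r`, leaving stale entries behind. A potential argument
(`Main.loop`) charges O((Δ+1) deg x + c) steps to the scan of x, and the degrees sum to 2m. -/

/-- The vertices reached from the start `i` by following `f`. -/
inductive Orbit {ι V : Type*} (f : ι ⊕ V → V ⊕ ι) (i : ι) : V → Prop where
  | base {v : V} : f (Sum.inl i) = Sum.inl v → Orbit f i v
  | step {v w : V} : Orbit f i v → f (Sum.inr v) = Sum.inl w → Orbit f i w

/-- An injective map can be followed backwards: orbits that meet agree all the way back, and a value
taken at a start is not taken at a vertex. -/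
theorem Orbit.eq_of_mem {ι V : Type*} {f : ι ⊕ V → V ⊕ ι} (hf : Function.Injective f) {i j : ι}
    {v : V} (hi : Orbit f i v) (hj : Orbit f j v) : i = j := by
  induction hi with
  | base h =>
    cases hj with
    | base h' => exact Sum.inl_injective (hf (h.trans h'.symm))
    | step _ h' => exact absurd (hf (h.trans h'.symm)) Sum.inl_ne_inr
  | step _ h ih =>
    cases hj with
    | base h' => exact absurd (hf (h.trans h'.symm)) Sum.inr_ne_inl
    | step h₁ h' =>
      have := Sum.inr_injective (hf (h.trans h'.symm))
      subst this
      exact ih h₁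

/-- Otherwise `f` would map the orbit together with its start injectively into the orbit, a finite
set with one element fewer. -/
theorem Orbit.exists_exit {ι V : Type*} [Finite V] {f : ι ⊕ V → V ⊕ ι}
    (hf : Function.Injective f) (i : ι) : (∃ v j, Orbit f i v ∧ f (Sum.inr v) = Sum.inr j) ∨
      ∃ j, f (Sum.inl i) = Sum.inr j := by
  by_contra! hcon
  obtain ⟨h₁, h₂⟩ := hcon
  have key : ∀ o : Option {v // Orbit f i v}, ∃ w : {v // Orbit f i v},
      f (o.elim (Sum.inl i) (fun v => Sum.inr v.1)) = Sum.inl w.1 := by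
    rintro (_ | ⟨v, hv⟩)
    · rcases h : f (Sum.inl i) with w | j
      · exact ⟨⟨w, .base h⟩, h⟩
      · exact absurd h (h₂ j)
    · rcases h : f (Sum.inr v) with w | j
      · exact ⟨⟨w, .step hv h⟩, h⟩
      · exact absurd h (h₁ v j hv)
  choose g hg using key
  have hinj : Function.Injective g := by
    intro a b hab
    have := hf ((hg a).trans ((congrArg (fun w => Sum.inl w.1) hab).trans (hg b).symm))
    rcases a with _ | a <;> rcases b with _ | b <;> simp_all [Subtype.ext_iff]
  have := Finite.card_option (α := {v // Orbit f i v})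
  have h := Nat.card_le_card_of_injective g hinj
  omega

/-- Menger as a matching problem. A start may be matched to a neighbour of `x`, a vertex to itself
(it is then unused) or to a neighbour, and a neighbour of `y` to one of `k` ends; `x` and `y` may
only be matched to themselves. A system of distinct representatives encodes disjoint paths, read off
as the orbits of the starts. -/
theorem exists_linkage {V : Type*} [Fintype V] [DecidableEq V] (G : SimpleGraph V) (k : ℕ)
    (x y : V) (hne : x ≠ y) (hna : ¬ G.Adj x y)
    (h : ∀ T : Finset V, T.card < k → x ∉ T → y ∉ T →
      Relation.ReflTransGen (fun a b => G.Adj a b ∧ a ∉ T ∧ b ∉ T) x y) :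
    ∃ f : Fin k ⊕ V → V ⊕ Fin k, Function.Injective f ∧ f (Sum.inr x) = Sum.inl x ∧
      f (Sum.inr y) = Sum.inl y ∧ (∀ i, ∃ v, f (Sum.inl i) = Sum.inl v ∧ G.Adj x v) ∧
      (∀ v w, f (Sum.inr v) = Sum.inl w → v = w ∨ G.Adj v w) ∧
      ∀ v j, f (Sum.inr v) = Sum.inr j → G.Adj v y := by
  classical
  let t : Fin k ⊕ V → Finset (V ⊕ Fin k) := fun a => Finset.univ.filter fun b =>
    match a, b with
    | Sum.inl _, Sum.inl v => G.Adj x v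
    | Sum.inl _, Sum.inr _ => False
    | Sum.inr v, Sum.inl w => v = w ∨ (v ≠ x ∧ v ≠ y ∧ G.Adj v w)
    | Sum.inr v, Sum.inr _ => v ≠ x ∧ v ≠ y ∧ G.Adj v y
  have hall : ∀ Z : Finset (Fin k ⊕ V), Z.card ≤ (Z.biUnion t).card := by
    intro Z
    set I := Z.toLeft with hI
    set W := Z.toRight with hW
    have hZ : Z.card = I.card + W.card := Z.card_toLeft_add_card_toRight.symm
    have hIk : I.card ≤ k := by simpa using Finset.card_le_univ I
    set N := (Z.biUnion t).toLeft with hN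
    set N' := (Z.biUnion t).toRight with hN'
    have hU : (Z.biUnion t).card = N.card + N'.card :=
      (Finset.card_toLeft_add_card_toRight).symm
    have hWN : W ⊆ N := by
      intro v hv
      simp only [hN, Finset.mem_toLeft, Finset.mem_biUnion]
      exact ⟨Sum.inr v, by simpa [hW] using hv, by simp [t]⟩
    have hWc := Finset.card_le_card hWN
    rcases I.eq_empty_or_nonempty with hI0 | ⟨i, hi⟩
    · simp [hI0] at hZ
      omega
    by_cases hex : ∃ v ∈ W, v ≠ x ∧ v ≠ y ∧ G.Adj v y
    · obtain ⟨v, hv, hvx⟩ := hex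
      have : N' = Finset.univ := by
        ext j
        simp only [hN', Finset.mem_toRight, Finset.mem_biUnion, Finset.mem_univ, iff_true]
        exact ⟨Sum.inr v, by simpa [hW] using hv, by simpa [t] using hvx⟩
      rw [this, Finset.card_univ, Fintype.card_fin] at hU
      omega
    push Not at hex
    -- `T` separates `x` from `y`: a walk from `x` that avoids `T` stays in `W` after leaving `x`,
    -- and no vertex of `W` leads to `y`. So `T` has at least `k` elements, enough for the at most
    -- `k` starts in `Z`.
    set T := (N \ W).filter fun v => v ≠ x ∧ v ≠ y with hT
    have hTc : T.card + W.card ≤ N.card := by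
      have : T.card ≤ (N \ W).card := Finset.card_le_card (Finset.filter_subset _ _)
      have h2 := Finset.card_sdiff_add_card_eq_card hWN
      omega
    by_cases hTk : T.card < k
    swap
    · omega
    exfalso
    have hr := h T hTk (by simp [hT]) (by simp [hT])
    have hcl : ∀ z, Relation.ReflTransGen (fun a b => G.Adj a b ∧ a ∉ T ∧ b ∉ T) x z →
        z = x ∨ (z ∈ W ∧ z ≠ y) := by
      intro z hz
      induction hz with
      | refl => exact Or.inl rfl
      | @tail a b _ hab ih =>
        obtain ⟨hadj, -, hb⟩ := hab
        by_cases hbx : b = x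
        · exact Or.inl hbx
        right
        have hbN : b ∈ N ∧ b ≠ y := by
          by_cases hax : a = x
          · subst hax
            refine ⟨?_, fun hby => hna (hby ▸ hadj)⟩
            simp only [hN, Finset.mem_toLeft, Finset.mem_biUnion]
            exact ⟨Sum.inl i, by simpa [hI] using hi, by simpa [t] using hadj⟩
          · rcases ih with ih | ⟨ih, hay⟩
            · exact absurd ih hax
            refine ⟨?_, fun hby => hex a ih hax hay (hby ▸ hadj)⟩
            simp only [hN, Finset.mem_toLeft, Finset.mem_biUnion]
            exact ⟨Sum.inr a, by simpa [hW] using ih, by simp [t, hax, hay, hadj]⟩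
        refine ⟨?_, hbN.2⟩
        by_contra hbW
        exact hb (by simp [hT, hbN, hbW, hbx])
    rcases hcl y hr with h | h
    · exact hne h.symm
    · exact h.2 rfl
  obtain ⟨f, hf, hft⟩ := (Finset.all_card_le_biUnion_card_iff_exists_injective t).1 hall
  have key : ∀ v w, f (Sum.inr v) = Sum.inl w → v = w ∨ (v ≠ x ∧ v ≠ y ∧ G.Adj v w) := by
    intro v w hvw
    have := hft (Sum.inr v)
    rw [hvw] at this
    simpa [t] using this
  have key' : ∀ v j, f (Sum.inr v) = Sum.inr j → v ≠ x ∧ v ≠ y ∧ G.Adj v y := by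
    intro v j hvj
    have := hft (Sum.inr v)
    rw [hvj] at this
    simpa [t] using this
  refine ⟨f, hf, ?_, ?_, ?_, ?_, fun v j hvj => (key' v j hvj).2.2⟩
  · rcases hx : f (Sum.inr x) with w | j
    · rcases key x w hx with h | h
      · rw [h]
      · exact absurd rfl h.1
    · exact absurd rfl (key' x j hx).1
  · rcases hx : f (Sum.inr y) with w | j
    · rcases key y w hx with h | h
      · rw [h]
      · exact absurd rfl h.2.1
    · exact absurd rfl (key' y j hx).2.1
  · intro i
    have := hft (Sum.inl i)
    rcases hi : f (Sum.inl i) with v | j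
    · exact ⟨v, rfl, by simpa [t, hi] using this⟩
    · simp [t, hi] at this
  · intro v w hvw
    exact (key v w hvw).imp_right fun h => h.2.2

/-- Menger's theorem: non-adjacent vertices that fewer than `k` others never separate are joined by
`k` paths. -/
theorem joinedBy_of_forall_reachable {V : Type*} [Fintype V] [DecidableEq V] (G : SimpleGraph V)
    (k : ℕ) (x y : V) (hne : x ≠ y) (hna : ¬ G.Adj x y)
    (h : ∀ T : Finset V, T.card < k → x ∉ T → y ∉ T →
      Relation.ReflTransGen (fun a b => G.Adj a b ∧ a ∉ T ∧ b ∉ T) x y) :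
    JoinedBy G k x y := by
  obtain ⟨f, hf, hfx, hfy, h₁, h₂, h₃⟩ := exists_linkage G k x y hne hna h
  have hwalk : ∀ i v, Orbit f i v → ∃ p : G.Walk x v, ∀ z ∈ p.support, z = x ∨ Orbit f i z := by
    intro i v hv
    induction hv with
    | base hv =>
      obtain ⟨w, hw, hadj⟩ := h₁ i
      obtain rfl : w = _ := Sum.inl_injective (hw.symm.trans hv)
      exact ⟨.cons hadj .nil, by simpa using Or.inr (Orbit.base hv)⟩
    | @step v w hv hvw ih =>
      obtain ⟨p, hp⟩ := ih
      rcases h₂ v w hvw with rfl | hadj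
      · exact ⟨p, hp⟩
      · refine ⟨p.concat hadj, fun z hz => ?_⟩
        rw [SimpleGraph.Walk.support_concat, List.mem_append] at hz
        rcases hz with hz | hz
        · exact hp z hz
        · obtain rfl : z = w := by simpa using hz
          exact Or.inr (.step hv hvw)
  have hpath : ∀ i, ∃ p : G.Path x y, ∀ z ∈ (p : G.Walk x y).support,
      z = x ∨ z = y ∨ Orbit f i z := by
    intro i
    rcases Orbit.exists_exit hf i with ⟨v, j, hv, hvj⟩ | ⟨j, hj⟩
    · obtain ⟨p, hp⟩ := hwalk i v hv
      classical
      refine ⟨(p.concat (h₃ v j hvj)).toPath, fun z hz => ?_⟩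
      have hz := SimpleGraph.Walk.support_bypass_subset_support _ hz
      rw [SimpleGraph.Walk.support_concat, List.mem_append] at hz
      rcases hz with hz | hz
      · exact (hp z hz).imp_right Or.inr
      · exact Or.inr (Or.inl (by simpa using hz))
    · obtain ⟨w, hw, -⟩ := h₁ i
      simp [hj] at hw
  choose P hP using hpath
  have hdisj : ∀ i j, i ≠ j → ∀ z, z ∈ (P i : G.Walk x y).support →
      z ∈ (P j : G.Walk x y).support → z = x ∨ z = y := by
    intro i j hij z hi hj
    have h1 := hP i z hi
    have h2 := hP j z hj
    by_contra hcon
    push Not at hcon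
    simp only [hcon, false_or] at h1 h2
    exact hij (h1.eq_of_mem hf h2)
  refine ⟨P, fun i j hij => ?_, hdisj⟩
  by_contra hne'
  have hd := hdisj i j hne'
  rw [← hij] at hd
  -- Two equal paths would have all their vertices in {x, y}; the second vertex of the path
  -- contradicts this, as `x` and `y` are not adjacent.
  rcases hp : (P i : G.Walk x y) with _ | ⟨hadj, q⟩
  · exact hne rfl
  · rename_i u
    have hu : u ∈ (P i : G.Walk x y).support := by rw [hp]; simp
    rcases hd u hu hu with rfl | rfl
    · exact G.loopless.irrefl _ hadj
    · exact hna hadj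

theorem JoinedBy.map {V W : Type*} {G : SimpleGraph V} {G' : SimpleGraph W} {k : ℕ} {u w : V}
    (h : JoinedBy G k u w) (g : G →g G') (hg : Function.Injective g) :
    JoinedBy G' k (g u) (g w) := by
  obtain ⟨P, hP, hd⟩ := h
  refine ⟨fun i => (P i).map g hg, fun i j hij => hP ?_, fun i j hij x hi hj => ?_⟩
  · exact SimpleGraph.Path.map_injective hg u w hij
  · simp only [SimpleGraph.Path.map_coe, SimpleGraph.Walk.support_map, List.mem_map] at hi hj
    obtain ⟨a, ha, rfl⟩ := hi
    obtain ⟨b, hb, hab⟩ := hj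
    obtain rfl := hg hab
    exact (hd i j hij b ha hb).imp (congrArg g) (congrArg g)

/-! ### The selection process

A partial function `sel` assigns to each selected vertex `v` outside `X` an ordered pair of its
neighbours, which `v` links. -/

/-- `v` is selected, and links `x` with another vertex. -/
def Links {V : Type*} (sel : V → Option (V × V)) (v x : V) : Prop :=
  ∃ p, sel v = some p ∧ (x = p.1 ∨ x = p.2)

/-- `u` and `w` are connected by links through vertices with property `P`. -/
def Conn {V : Type*} (sel : V → Option (V × V)) (P : V → Prop) (u w : V) : Prop :=
  Relation.ReflTransGen (fun a b => (Links sel a b ∨ Links sel b a) ∧ P a ∧ P b) u w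

/-- Fewer than `c` other vertices never separate `u` from `w` in the graph of links. -/
def Linked {V : Type*} (sel : V → Option (V × V)) (c : ℕ) (u w : V) : Prop :=
  ∀ T : Finset V, T.card < c → u ∉ T → w ∉ T → Conn sel (· ∉ T) u w

open Classical in
/-- The number of selected vertices that link `x` with `y`. -/
noncomputable def mult {V : Type*} [Fintype V] (sel : V → Option (V × V)) (x y : V) : ℕ :=
  (Finset.univ.filter fun v => sel v = some (x, y)).card

open Classical in
/-- The number of selected vertices whose second neighbour is `y`. -/
noncomputable def load {V : Type*} [Fintype V] (sel : V → Option (V × V)) (y : V) : ℕ :=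
  (Finset.univ.filter fun v => ∃ x, sel v = some (x, y)).card

section
variable {V : Type*} {sel sel₀ : V → Option (V × V)} {P Q : V → Prop} {u v w x y : V} {c : ℕ}

theorem Conn.symm (h : Conn sel P u w) : Conn sel P w u :=
  have : Std.Symm fun a b => (Links sel a b ∨ Links sel b a) ∧ P a ∧ P b :=
    ⟨fun _ _ h => ⟨h.1.symm, h.2.2, h.2.1⟩⟩
  Relation.ReflTransGen.stdSymm.symm _ _ h

theorem Conn.trans (h : Conn sel P u v) (h' : Conn sel P v w) : Conn sel P u w :=
  Relation.ReflTransGen.trans h h'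

theorem Links.mono (hs : ∀ v p, sel₀ v = some p → sel v = some p) (h : Links sel₀ u w) :
    Links sel u w :=
  let ⟨p, hp, h⟩ := h
  ⟨p, hs _ _ hp, h⟩

theorem Conn.mono (h : Conn sel₀ P u w) (hs : ∀ v p, sel₀ v = some p → sel v = some p)
    (hPQ : ∀ z, P z → Q z) : Conn sel Q u w :=
  Relation.ReflTransGen.mono
    (fun _ _ h => ⟨h.1.imp (.mono hs) (.mono hs), hPQ _ h.2.1, hPQ _ h.2.2⟩) _ _ h

theorem Conn.of_sel (h : sel v = some (x, y)) (hv : P v) (hx : P x) (hy : P y) :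
    Conn sel P x y :=
  .head ⟨Or.inr ⟨_, h, Or.inl rfl⟩, hx, hv⟩ (.single ⟨Or.inl ⟨_, h, Or.inr rfl⟩, hv, hy⟩)

theorem Linked.symm (h : Linked sel c u w) : Linked sel c w u :=
  fun T hT hw hu => (h T hT hu hw).symm

theorem Linked.mono (h : Linked sel₀ c u w) (hs : ∀ v p, sel₀ v = some p → sel v = some p) :
    Linked sel c u w :=
  fun T hT hu hw => (h T hT hu hw).mono hs fun _ h => h

variable [Fintype V]

theorem linked_of_le_mult (h : c ≤ mult sel x y) : Linked sel c x y := by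
  classical
  intro T hT hx hy
  obtain ⟨v, hv, hvT⟩ := Finset.exists_mem_notMem_of_card_lt_card (hT.trans_le h)
  exact Conn.of_sel (by simpa using hv) hvT hx hy

/-- The invariant of the process, with `A` the set of scanned vertices and `r y` the number of
vertices of `A` that are linked with `y` while `y` is unscanned. -/
structure Inv (F : SimpleGraph V) (X : Finset V) (c : ℕ) (A : Finset V)
    (sel : V → Option (V × V)) (r : V → ℕ) : Prop where
  sub : A ⊆ X
  sel_spec : ∀ v x y, sel v = some (x, y) → v ∉ X ∧ F.Adj v x ∧ F.Adj v y ∧ x ∈ A ∧ y ∈ X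
  conn : ∀ u w, u ∈ X → w ∈ X → u ∉ A → w ∉ A → ∀ T : Finset V, T.card < r u → T.card < r w →
    u ∉ T → w ∉ T → Conn sel (fun z => (z ∈ A ∨ z ∉ X ∨ z = u ∨ z = w) ∧ z ∉ T) u w
  linked : ∀ x ∈ A, ∀ v, v ∉ X → sel v = none → F.Adj v x → ∀ y, F.Adj v y → y ≠ x →
    Linked sel c x y
  load_le : ∀ y, load sel y ≤ c * (c - 1) + 1
  load_le_mul : ∀ y, load sel y ≤ c * r y
  r_le : ∀ y, r y ≤ c

/-- The invariant of the scan of `x`, with `sel₀`, `r₀` the data before the scan. -/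
structure Scan (F : SimpleGraph V) (X : Finset V) (c : ℕ) (A : Finset V) (x : V)
    (sel₀ : V → Option (V × V)) (r₀ : V → ℕ) (sel : V → Option (V × V)) (r : V → ℕ) : Prop where
  ext : ∀ v p, sel₀ v = some p → sel v = some p
  new : ∀ v a b, sel v = some (a, b) → sel₀ v = none →
    a = x ∧ v ∉ X ∧ F.Adj v x ∧ F.Adj v b ∧ b ∈ X ∧ b ∉ A ∧ b ≠ x
  r_eq : ∀ y, r y = r₀ y + if mult sel x y = 0 then 0 else 1
  r_le : ∀ y, r y ≤ c
  mult_le : ∀ y, mult sel x y ≤ c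
  load_le : ∀ y, load sel y ≤ c * (c - 1) + 1
  load_le_mul : ∀ y, load sel y ≤ c * r₀ y + mult sel x y

variable {F : SimpleGraph V} {X A : Finset V} {r r₀ : V → ℕ}

theorem Inv.init (F : SimpleGraph V) (X : Finset V) (c : ℕ) :
    Inv F X c ∅ (fun _ => none) (fun _ => 0) where
  sub := by simp
  sel_spec := by simp
  conn := by simp
  linked := by simp
  load_le := by simp [load]
  load_le_mul := by simp [load]
  r_le := by simp

theorem Inv.mult_eq_zero (h : Inv F X c A sel r) (hx : x ∉ A) (y : V) : mult sel x y = 0 := by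
  classical
  simp only [mult, Finset.card_eq_zero, Finset.filter_eq_empty_iff]
  intro v _ hv
  exact hx (h.sel_spec v x y hv).2.2.2.1

theorem Scan.sel₀_eq_none (h : Scan F X c A x sel₀ r₀ sel r) (hI : Inv F X c A sel₀ r₀)
    (hx : x ∉ A) (hv : sel v = some (x, y)) : sel₀ v = none := by
  rcases hs : sel₀ v with _ | ⟨a, b⟩
  · rfl
  · have := (h.ext v _ hs).symm.trans hv
    simp only [Option.some.injEq, Prod.mk.injEq] at this
    exact absurd (this.1 ▸ (hI.sel_spec v a b hs).2.2.2.1) hx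

theorem Inv.scan (h : Inv F X c A sel r) (hx : x ∉ A) : Scan F X c A x sel r sel r where
  ext := fun _ _ h => h
  new := by simp +contextual
  r_eq := by simp [h.mult_eq_zero hx]
  r_le := h.r_le
  mult_le := by simp [h.mult_eq_zero hx]
  load_le := h.load_le
  load_le_mul := fun y => (h.load_le_mul y).trans (by omega)

/-! ### Effect of a single selection and of a completed scan. -/

variable [DecidableEq V]

theorem mult_update (hv : sel v = none) (x y a b : V) :
    mult (Function.update sel v (some (x, y))) a b =
      mult sel a b + if a = x ∧ b = y then 1 else 0 := by
  classical
  unfold mult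
  split_ifs with h
  · obtain ⟨rfl, rfl⟩ := h
    rw [← Finset.card_insert_of_notMem (a := v) (by simp [hv])]
    congr 1
    ext z
    by_cases hz : z = v <;> simp [Function.update_apply, hz]
  · congr 1
    ext z
    by_cases hz : z = v <;> simp [Function.update_apply, hz, hv]
    rintro rfl rfl
    exact h ⟨rfl, rfl⟩

theorem load_update (hv : sel v = none) (x y b : V) :
    load (Function.update sel v (some (x, y))) b = load sel b + if b = y then 1 else 0 := by
  classical
  unfold load
  split_ifs with h
  · subst h
    rw [← Finset.card_insert_of_notMem (a := v) (by simp [hv])]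
    congr 1
    ext z
    by_cases hz : z = v <;> simp [Function.update_apply, hz]
  · congr 1
    ext z
    by_cases hz : z = v <;> simp [Function.update_apply, hz, hv]
    rintro rfl
    exact h rfl

theorem Scan.select (h : Scan F X c A x sel₀ r₀ sel r) (hsv : sel v = none) (hv : v ∉ X)
    (hvx : F.Adj v x) (hvy : F.Adj v y) (hy : y ∈ X) (hyA : y ∉ A) (hyx : y ≠ x) (hr : r y < c)
    (hm : mult sel x y < c) :
    Scan F X c A x sel₀ r₀ (Function.update sel v (some (x, y)))
      (Function.update r y (if mult sel x y = 0 then r y + 1 else r y)) where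
  ext z p hz := by
    have := h.ext z p hz
    rw [Function.update_of_ne, this]
    rintro rfl
    simp [hsv] at this
  new z a b hz hz₀ := by
    by_cases hzv : z = v
    · subst hzv
      simp only [Function.update_self, Option.some.injEq, Prod.mk.injEq] at hz
      obtain ⟨rfl, rfl⟩ := hz
      exact ⟨rfl, hv, hvx, hvy, hy, hyA, hyx⟩
    · rw [Function.update_of_ne hzv] at hz
      exact h.new z a b hz hz₀
  r_eq z := by
    rw [mult_update hsv]
    have := h.r_eq z
    by_cases hz : z = y
    · subst hz
      simp only [Function.update_self]
      split_ifs at * <;> simp_all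
    · simp [hz, this]
  r_le z := by
    have := h.r_le z
    by_cases hz : z = y
    · subst hz
      simp only [Function.update_self]
      split_ifs <;> omega
    · simpa [Function.update_of_ne hz]
  mult_le z := by
    rw [mult_update hsv]
    have := h.mult_le z
    by_cases hz : z = y
    · subst hz
      simpa using hm
    · simpa [hz]
  load_le z := by
    rw [load_update hsv]
    by_cases hz : z = y
    · subst hz
      have h1 := h.load_le_mul z
      have h2 := h.r_eq z
      simp only [if_true, Nat.add_le_add_iff_right]
      refine h1.trans ?_
      -- If this is the first link of `x` with `z`, then `r₀ z = r z ≤ c - 1` and the +1 is the new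
      -- link. Otherwise `r₀ z + 1 = r z ≤ c - 1`, and the links of this scan, at most `c`, are
      -- absorbed in the product.
      split_ifs at h2 with h0
      · rw [h0, add_zero]
        exact Nat.mul_le_mul_left _ (by omega)
      · calc c * r₀ z + mult sel x z ≤ c * (r₀ z + 1) := by rw [mul_add]; omega
          _ ≤ _ := Nat.mul_le_mul_left _ (by omega)
    · simpa [hz] using h.load_le z
  load_le_mul z := by
    rw [load_update hsv, mult_update hsv]
    have := h.load_le_mul z
    by_cases hz : z = y
    · simp [hz]
      subst hz
      omega
    · simpa [hz]

omit [DecidableEq V] in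
-- This is where the maximality of `r₀ x` is used. A link vertex between `x` and `u` outside `T`
-- settles the claim. If there are no links at all, then `r u = r₀ u ≤ r₀ x` and the old invariant
-- applies to `x` and `u`. Otherwise some link vertex `v` lies in `T`, and removing it from `T`
-- makes up for the increase of `r u` by one.
theorem Scan.conn (h : Scan F X c A x sel₀ r₀ sel r) (hI : Inv F X c A sel₀ r₀) (hx : x ∉ A)
    (hxX : x ∈ X) (hmax : ∀ z ∈ X, z ∉ A → r₀ z ≤ r₀ x) (hu : u ∈ X) (huA : u ∉ A)
    {T : Finset V} (hT : T.card < r u) (hxT : x ∉ T) (huT : u ∉ T) :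
    Conn sel (fun z => (z ∈ A ∨ z ∉ X ∨ z = x ∨ z = u) ∧ z ∉ T) x u := by
  classical
  have hmx := hmax u hu huA
  by_cases hex : ∃ v, sel v = some (x, u) ∧ v ∉ T
  · obtain ⟨v, hv, hvT⟩ := hex
    have hv₀ := h.new v x u hv (h.sel₀_eq_none hI hx hv)
    exact .of_sel hv ⟨Or.inr (Or.inl hv₀.2.1), hvT⟩ (by simp [hxT]) (by simp [huT])
  push Not at hex
  have hr := h.r_eq u
  split_ifs at hr with hm
  · exact (hI.conn x u hxX hu hx huA T (by omega) (by omega) hxT huT).mono h.ext fun _ h => h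
  · obtain ⟨v, hv⟩ := Finset.card_ne_zero.1 hm
    replace hv : sel v = some (x, u) := by simpa using hv
    have hvT := hex v hv
    have hcard := Finset.card_erase_add_one hvT
    have hconn := hI.conn x u hxX hu hx huA (T.erase v) (by omega) (by omega) (by simp [hxT])
      (by simp [huT])
    have hv₀ := h.sel₀_eq_none hI hx hv
    -- The old connection cannot pass through `v`, which was unselected and lies outside `X`; so
    -- avoiding `T.erase v` it avoids `T` as well.
    refine Relation.ReflTransGen.mono (fun a b hab => ?_) _ _ hconn
    obtain ⟨hl, ha, hb⟩ := hab
    have hvX := (h.new v x u hv hv₀).2.1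
    have hav : a ≠ v ∧ b ≠ v := by
      constructor <;> rintro rfl
      · rcases hl with ⟨p, hp, -⟩ | ⟨p, hp, hap⟩
        · simp [hv₀] at hp
        · have := hI.sel_spec _ _ _ hp
          rcases hap with rfl | rfl
          · exact hvX (hI.sub this.2.2.2.1)
          · exact hvX this.2.2.2.2
      · rcases hl with ⟨p, hp, hap⟩ | ⟨p, hp, -⟩
        · have := hI.sel_spec _ _ _ hp
          rcases hap with rfl | rfl
          · exact hvX (hI.sub this.2.2.2.1)
          · exact hvX this.2.2.2.2
        · simp [hv₀] at hp
    exact ⟨hl.imp (.mono h.ext) (.mono h.ext), ⟨ha.1, fun hT => ha.2 (by simp [hT, hav])⟩,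
      ⟨hb.1, fun hT => hb.2 (by simp [hT, hav])⟩⟩

/-- Scanning an unscanned vertex `x` with `r₀ x` maximum preserves the invariant. -/
theorem Scan.finish (h : Scan F X c A x sel₀ r₀ sel r) (hI : Inv F X c A sel₀ r₀) (hx : x ∉ A)
    (hxX : x ∈ X) (hmax : ∀ z ∈ X, z ∉ A → r₀ z ≤ r₀ x) (hF : F.IsVertexCover (X : Set V))
    (hcov : ∀ v, v ∉ X → sel v = none → F.Adj v x → ∀ y, F.Adj v y → y ∉ A → y ≠ x →
      c ≤ r y ∨ c ≤ mult sel x y) :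
    Inv F X c (insert x A) sel r where
  sub := Finset.insert_subset hxX hI.sub
  sel_spec v a b hv := by
    rcases hs : sel₀ v with _ | ⟨a', b'⟩
    · obtain ⟨rfl, h1, h2, h3, h4, -⟩ := h.new v a b hv hs
      exact ⟨h1, h2, h3, by simp, h4⟩
    · have := (h.ext v _ hs).symm.trans hv
      simp only [Option.some.injEq, Prod.mk.injEq] at this
      obtain ⟨rfl, rfl⟩ := this
      have := hI.sel_spec v _ _ hs
      exact ⟨this.1, this.2.1, this.2.2.1, by simp [this.2.2.2.1], this.2.2.2.2⟩
  conn u w hu hw huA hwA T hTu hTw huT hwT := by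
    classical
    simp only [Finset.mem_insert, not_or] at huA hwA
    -- If `x` lies in `T`, erasing it offsets the growth of `r` by at most one, and the old
    -- connection does not use `x`, an unscanned vertex of `X` other than its ends. If not, `u` and
    -- `w` both reach `x`.
    by_cases hxT : x ∈ T
    · have hcard := Finset.card_erase_add_one hxT
      have hr := h.r_eq u
      have hr' := h.r_eq w
      have h1 := hI.conn u w hu hw huA.2 hwA.2 (T.erase x) (by split_ifs at hr <;> omega)
        (by split_ifs at hr' <;> omega) (by simp [huT]) (by simp [hwT])
      refine h1.mono h.ext fun z hz => ⟨?_, fun hzT => hz.2 ?_⟩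
      · simp only [Finset.mem_insert]
        tauto
      · simp only [Finset.mem_erase, hzT, and_true]
        rintro rfl
        rcases hz.1 with h | h | h | h
        · exact hx h
        · exact h hxX
        · exact huA.1 h.symm
        · exact hwA.1 h.symm
    · refine Conn.trans (v := x) (Conn.symm ?_) ?_
      · refine (h.conn hI hx hxX hmax hu huA.2 hTu hxT huT).mono (fun _ _ h => h) fun z hz => ?_
        simp only [Finset.mem_insert]
        tauto
      · refine (h.conn hI hx hxX hmax hw hwA.2 hTw hxT hwT).mono (fun _ _ h => h) fun z hz => ?_
        simp only [Finset.mem_insert]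
        tauto
  linked a ha v hv hsv hva y hvy hya := by
    have hs₀ : sel₀ v = none := by
      rcases hs : sel₀ v with _ | p
      · rfl
      · simp [h.ext v p hs] at hsv
    rw [Finset.mem_insert] at ha
    rcases ha with rfl | ha
    · by_cases hyA : y ∈ A
      · exact ((hI.linked y hyA v hv hs₀ hvy a hva hya.symm).symm).mono h.ext
      · rcases hcov v hv hsv hva y hvy hyA hya with hr | hm
        · intro T hT haT hyT
          have hyX : y ∈ X := (hF hvy).resolve_left hv
          exact (h.conn hI hx hxX hmax hyX hyA (hT.trans_le hr) haT hyT).mono (fun _ _ h => h)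
            fun z hz => hz.2
        · exact linked_of_le_mult hm
    · exact (hI.linked a ha v hv hs₀ hva y hvy hya).mono h.ext
  load_le := h.load_le
  load_le_mul y := by
    refine (h.load_le_mul y).trans ?_
    have := h.r_eq y
    have hm := h.mult_le y
    split_ifs at this with h0
    · rw [this, h0, add_zero, add_zero]
    · rw [this, mul_add]
      omega
  r_le := h.r_le

end

/-! ### The subgraph obtained at the end of the process -/

section
variable {V : Type*} {F : SimpleGraph V} {X : Finset V} {c : ℕ} {sel : V → Option (V × V)}
  {r : V → ℕ} {u v w : V}

/-- The subgraph induced by `X` and the selected vertices. -/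
def cover (F : SimpleGraph V) (X : Finset V) (sel : V → Option (V × V)) : F.Subgraph :=
  (⊤ : F.Subgraph).induce {v | v ∈ X ∨ sel v ≠ none}

theorem mem_cover : v ∈ (cover F X sel).verts ↔ v ∈ X ∨ sel v ≠ none := Iff.rfl

theorem cover_adj : (cover F X sel).Adj u v ↔
    u ∈ (cover F X sel).verts ∧ v ∈ (cover F X sel).verts ∧ F.Adj u v := by
  simp [cover]

variable [Fintype V]

theorem Inv.cover_adj_of_links (h : Inv F X c X sel r) (hl : Links sel u v) :
    (cover F X sel).Adj u v ∧ u ∉ X ∧ v ∈ X := by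
  obtain ⟨⟨x, y⟩, hp, hv⟩ := hl
  have := h.sel_spec u x y hp
  rw [cover_adj, mem_cover, mem_cover]
  rcases hv with rfl | rfl <;> simp_all

/-- Each selected vertex is charged to its second neighbour in `X`, which bears at most c(c-1)+1
charges; one more accounts for `X` itself. -/
theorem Inv.ncard_cover_le (h : Inv F X c X sel r) :
    (cover F X sel).verts.ncard ≤ (c * (c - 1) + 2) * X.card := by
  classical
  have hsub : (cover F X sel).verts ⊆
      ↑(X ∪ X.biUnion fun y => Finset.univ.filter fun v => ∃ x, sel v = some (x, y)) := by
    intro v hv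
    rw [mem_cover] at hv
    simp only [Finset.coe_union, Set.mem_union, Finset.mem_coe, Finset.mem_biUnion,
      Finset.mem_filter, Finset.mem_univ, true_and]
    refine hv.imp_right fun hv => ?_
    obtain ⟨⟨x, y⟩, hp⟩ := Option.ne_none_iff_exists'.1 hv
    exact ⟨y, (h.sel_spec v x y hp).2.2.2.2, x, hp⟩
  refine (Set.ncard_le_ncard hsub (Finset.finite_toSet _)).trans ?_
  rw [Set.ncard_coe_finset]
  refine (Finset.card_union_le _ _).trans ?_
  have h2 : (X.biUnion fun y => Finset.univ.filter fun v => ∃ x, sel v = some (x, y)).card ≤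
      X.card * (c * (c - 1) + 1) := by
    refine Finset.card_biUnion_le_card_mul _ _ _ fun y _ => ?_
    have := h.load_le y
    simp only [load] at this
    convert this
  calc _ ≤ X.card + X.card * (c * (c - 1) + 1) := by omega
    _ = _ := by ring

/-- The process gives a quadratic bound, which meets the factorial one with equality at `c = 1` and
`c = 2`. -/
theorem mul_pred_add_two_le_factorial (hc : 1 ≤ c) : c * (c - 1) + 2 ≤ 2 * c ! := by
  induction c, hc using Nat.le_induction with
  | base => simp
  | succ c hc ih =>
    obtain ⟨d, rfl⟩ := Nat.exists_eq_add_of_le' hc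
    rw [Nat.factorial_succ]
    simp only [Nat.add_sub_cancel] at *
    nlinarith [Nat.factorial_pos (d + 1), Nat.mul_le_mul_left (d + 2) ih]

theorem Inv.cover_linked (h : Inv F X c X sel r) (hF : F.IsVertexCover (X : Set V))
    (hv : v ∉ (cover F X sel).verts) (hu : F.Adj v u) (hw : F.Adj v w) (huw : u ≠ w) :
    u ∈ X ∧ w ∈ X ∧ Linked sel c u w := by
  rw [mem_cover, not_or, not_not] at hv
  have huX : u ∈ X := (hF hu).resolve_left hv.1
  have hwX : w ∈ X := (hF hw).resolve_left hv.1
  exact ⟨huX, hwX, h.linked u huX v hv.1 hv.2 hu w hw huw.symm⟩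

/-- Menger's theorem is applied to the graph of links alone. Its edges all run between `X` and the
complement of `X`, so `u` and `w` are non-adjacent there, even if they are adjacent in `F`. -/
theorem Inv.joinedBy (h : Inv F X c X sel r) (hu : u ∈ X) (hw : w ∈ X) (huw : u ≠ w)
    (hl : Linked sel c u w) (huJ : u ∈ (cover F X sel).verts)
    (hwJ : w ∈ (cover F X sel).verts) :
    JoinedBy (cover F X sel).coe c ⟨u, huJ⟩ ⟨w, hwJ⟩ := by
  classical
  let B : SimpleGraph (cover F X sel).verts :=
    { Adj := fun a b => Links sel a b ∨ Links sel b a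
      symm := ⟨fun _ _ h => h.symm⟩
      loopless := ⟨fun a ha => by
        rcases ha with ha | ha <;> exact (h.cover_adj_of_links ha).1.ne rfl⟩ }
  have hB : B ≤ (cover F X sel).coe := by
    intro a b hab
    rcases hab with hab | hab
    · exact (h.cover_adj_of_links hab).1
    · exact (h.cover_adj_of_links hab).1.symm
  refine JoinedBy.map (joinedBy_of_forall_reachable B c ⟨u, huJ⟩ ⟨w, hwJ⟩ (by simpa) ?_ ?_)
    (SimpleGraph.Hom.ofLE hB) Function.injective_id
  · rintro (hab | hab)
    · exact (h.cover_adj_of_links hab).2.1 hu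
    · exact (h.cover_adj_of_links hab).2.1 hw
  · intro T hT huT hwT
    have hc := hl (T.map (Function.Embedding.subtype _)) (by simpa) (by simpa using fun _ => huT)
      (by simpa using fun _ => hwT)
    have key : ∀ z, Conn sel (· ∉ T.map (Function.Embedding.subtype _)) u z →
        ∃ hz : z ∈ (cover F X sel).verts, Relation.ReflTransGen
          (fun a b => B.Adj a b ∧ a ∉ T ∧ b ∉ T) ⟨u, huJ⟩ ⟨z, hz⟩ := by
      intro z hz
      induction hz with
      | refl => exact ⟨huJ, .refl⟩
      | @tail a b _ hab ih =>
        obtain ⟨ha, ih⟩ := ih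
        obtain ⟨hl, haT, hbT⟩ := hab
        have hb : b ∈ (cover F X sel).verts := by
          rcases hl with hl | hl
          · exact (h.cover_adj_of_links hl).1.snd_mem
          · exact (h.cover_adj_of_links hl).1.fst_mem
        refine ⟨hb, ih.tail ⟨hl, ?_, ?_⟩⟩
        · simpa [ha] using haT
        · simpa [hb] using hbT
    exact (key w hc).2

/-! ### 3-connectivity of the resulting subgraph. -/

theorem exists_adj_of_isKConnected {k : ℕ} (hk : IsKConnected F k) (v : V) {W : Set V}
    (hW : W.ncard < k) (hv : v ∉ W) : ∃ u, F.Adj v u ∧ u ∉ W := by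
  have hcard : (insert v W).ncard < Nat.card V :=
    ((Set.ncard_insert_le v W).trans (Nat.succ_le_of_lt hW)).trans_lt hk.1
  obtain ⟨z, hz⟩ : ∃ z, z ∉ insert v W := by
    by_contra! hcon
    rw [Set.eq_univ_of_forall hcon, Set.ncard_univ] at hcard
    exact lt_irrefl _ hcard
  rw [Set.mem_insert_iff, not_or] at hz
  obtain ⟨p⟩ := (hk.2 W hW).preconnected ⟨v, hv⟩ ⟨z, hz.2⟩
  rcases p with _ | ⟨hadj, _⟩
  · exact absurd rfl hz.1
  · rename_i z _
    exact ⟨z, hadj, z.2⟩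

/-- A vertex outside the subgraph has three neighbours, all in `X`. Two of them are connected by
links, and any link vertex on the way lies outside `X`, hence is a fourth vertex. -/
theorem three_lt_ncard_cover (h : Inv F X c X sel r) (hF : F.IsVertexCover (X : Set V))
    (hc : 3 ≤ c) (hk : IsKConnected F 3) : 3 < (cover F X sel).verts.ncard := by
  by_cases hall : (cover F X sel).verts = Set.univ
  · rw [hall, Set.ncard_univ]
    exact hk.1
  obtain ⟨v, hv⟩ := (Set.ne_univ_iff_exists_notMem _).1 hall
  obtain ⟨a, ha, -⟩ := exists_adj_of_isKConnected hk v (W := ∅) (by simp) (by simp)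
  obtain ⟨b, hb, hba⟩ := exists_adj_of_isKConnected hk v (W := {a}) (by simp) (by simpa using ha.ne)
  obtain ⟨d, hd, hdab⟩ := exists_adj_of_isKConnected hk v (W := {a, b})
    ((Set.ncard_insert_le _ _).trans_lt (by simp)) (by simp [ha.ne, hb.ne])
  simp only [Set.mem_singleton_iff, Set.mem_insert_iff, not_or] at hba hdab
  obtain ⟨haX, hbX, hl⟩ := h.cover_linked hF hv ha hb (Ne.symm hba)
  have hdX := (h.cover_linked hF hv ha hd (Ne.symm hdab.1)).2.1
  have hconn := hl ∅ (by simp; omega) (by simp) (by simp)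
  rcases Relation.ReflTransGen.cases_head hconn with hab | ⟨s, ⟨hs, -⟩, -⟩
  · exact absurd hab.symm hba
  have hsJ : s ∈ (cover F X sel).verts ∧ s ∉ X := by
    rcases hs with hs | hs
    · exact absurd haX (h.cover_adj_of_links hs).2.1
    · exact ⟨(h.cover_adj_of_links hs).1.fst_mem, (h.cover_adj_of_links hs).2.1⟩
  have hsub : ({s, a, b, d} : Set V) ⊆ (cover F X sel).verts := by
    rintro z (rfl | rfl | rfl | rfl)
    · exact hsJ.1
    all_goals exact mem_cover.2 (Or.inl ‹_›)
  have hne : ∀ z ∈ X, s ≠ z := fun z hz hsz => hsJ.2 (hsz ▸ hz)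
  have h4 : ({s, a, b, d} : Set V).ncard = 4 := by
    rw [Set.ncard_insert_of_notMem, Set.ncard_insert_of_notMem, Set.ncard_pair]
    · exact Ne.symm hdab.2
    · simp [Ne.symm hba, Ne.symm hdab.1]
    · simp [hne a haX, hne b hbX, hne d hdX]
  have := Set.ncard_le_ncard hsub (Set.toFinite _)
  omega

theorem Inv.isKConnected_cover (h : Inv F X c X sel r) (hF : F.IsVertexCover (X : Set V))
    (hc : 3 ≤ c) (hk : IsKConnected F 3) : IsKConnected (cover F X sel).coe 3 := by
  classical
  have h3 := three_lt_ncard_cover h hF hc hk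
  set J := cover F X sel
  refine ⟨h3.trans_eq (Nat.card_coe_set_eq _).symm, fun W hW => ?_⟩
  set W' : Set V := Subtype.val '' W with hW'
  have hW'c : W'.ncard < 3 := by rwa [hW', Set.ncard_image_of_injective _ Subtype.val_injective]
  have hmem : ∀ (z : V) (hz : z ∈ J.verts), z ∉ W' ↔ (⟨z, hz⟩ : J.verts) ∉ W := by
    intro z hz
    simp [hW', hz]
  have hlink : ∀ a b (ha : a ∈ J.verts) (hb : b ∈ J.verts) (haW : (⟨a, ha⟩ : J.verts) ∈ Wᶜ)
      (hbW : (⟨b, hb⟩ : J.verts) ∈ Wᶜ), Linked sel c a b →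
      (J.coe.induce Wᶜ).Reachable ⟨⟨a, ha⟩, haW⟩ ⟨⟨b, hb⟩, hbW⟩ := by
    intro a b ha hb haW hbW hl
    have hconn := hl W'.toFinite.toFinset
      (by rw [← Set.ncard_eq_toFinset_card]; omega) (by simpa using (hmem a ha).2 haW)
      (by simpa using (hmem b hb).2 hbW)
    have key : ∀ z, Conn sel (· ∉ W'.toFinite.toFinset) a z →
        ∃ (hz : z ∈ J.verts) (hzW : (⟨z, hz⟩ : J.verts) ∈ Wᶜ),
          (J.coe.induce Wᶜ).Reachable ⟨⟨a, ha⟩, haW⟩ ⟨⟨z, hz⟩, hzW⟩ := by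
      intro z hz
      induction hz with
      | refl => exact ⟨ha, haW, .rfl⟩
      | @tail x y _ hxy ih =>
        obtain ⟨hx, hxW, ih⟩ := ih
        have hadj : J.Adj x y := by
          rcases hxy.1 with hl | hl
          · exact (h.cover_adj_of_links hl).1
          · exact (h.cover_adj_of_links hl).1.symm
        have hyW := (hmem y hadj.snd_mem).1 (by simpa using hxy.2.2)
        refine ⟨hadj.snd_mem, hyW, ih.trans (SimpleGraph.Adj.reachable ?_)⟩
        exact hadj
    exact (key b hconn).2.2
  -- Vertices outside `J` lie outside the cover `X`, so they are pairwise non-adjacent: a walk never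
  -- visits two of them in a row.
  have hsub : ∀ z, z ∉ J.verts → ∀ y, F.Adj z y → y ∈ J.verts := fun z hz y hzy =>
    mem_cover.2 (Or.inl ((hF hzy).resolve_left fun hzX => hz (mem_cover.2 (Or.inl hzX))))
  -- The walk is extended at its end. When it ends at a vertex outside `J`, the claim is made for
  -- every remaining neighbour `y` in `J` of that vertex; this strengthening lets the walk pass
  -- through such a vertex by `hlink`.
  have hpre : ∀ a b : ↥W'ᶜ, (F.induce W'ᶜ).Walk a b → ∀ (ha : (a : V) ∈ J.verts)
      (haW : (⟨a, ha⟩ : J.verts) ∈ Wᶜ), ∀ (y : V) (hy : y ∈ J.verts)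
      (hyW : (⟨y, hy⟩ : J.verts) ∈ Wᶜ), (y = b ∨ (b : V) ∉ J.verts ∧ F.Adj b y) →
      (J.coe.induce Wᶜ).Reachable ⟨⟨a, ha⟩, haW⟩ ⟨⟨y, hy⟩, hyW⟩ := by
    intro a b p ha haW
    induction p using SimpleGraph.Walk.concatRec with
    | Hnil =>
      rintro y hy hyW (rfl | ⟨hn, -⟩)
      · rfl
      · exact absurd ha hn
    | @Hconcat a b d p hbd ih =>
      intro y hy hyW hyd
      replace hbd : F.Adj b d := hbd
      have ih := ih ha haW
      by_cases hd : (d : V) ∈ J.verts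
      · obtain rfl : y = d := hyd.resolve_right fun h => h.1 hd
        by_cases hb : (b : V) ∈ J.verts
        · have hbW := (hmem b hb).1 b.2
          refine (ih b hb hbW (Or.inl rfl)).trans (SimpleGraph.Adj.reachable ?_)
          exact cover_adj.2 ⟨hb, hd, hbd⟩
        · exact ih d hd hyW (Or.inr ⟨hb, hbd⟩)
      · have hb := hsub d hd b hbd.symm
        have hbW := (hmem b hb).1 b.2
        have hdy : F.Adj d y := by
          rcases hyd with rfl | h
          · exact absurd hy hd
          · exact h.2
        refine (ih b hb hbW (Or.inl rfl)).trans ?_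
        by_cases hby : (b : V) = y
        · subst hby
          rfl
        · exact hlink b y hb hy hbW hyW (h.cover_linked hF hd hbd.symm hdy hby).2.2
  have : Nonempty ↥(Wᶜ : Set J.verts) := by
    rw [Set.nonempty_coe_sort, Set.nonempty_compl]
    rintro rfl
    rw [Set.ncard_univ, Nat.card_coe_set_eq] at hW
    omega
  refine ⟨fun a b => ?_⟩
  obtain ⟨⟨a, ha⟩, haW⟩ := a
  obtain ⟨⟨b, hb⟩, hbW⟩ := b
  obtain ⟨p⟩ := (hk.2 W' hW'c).preconnected ⟨a, (hmem a ha).2 haW⟩ ⟨b, (hmem b hb).2 hbW⟩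
  exact hpre _ _ p ha haW b hb hbW (Or.inl rfl)

end

/-! ### Weakest preconditions with a clock -/

/-- The program `p`, started in the state `s` at time `τ`, halts in a state and at a time that
satisfy `Q`. -/
def WP (p : Cmd) (Q : State → ℕ → Prop) (s : State) (τ : ℕ) : Prop :=
  ∃ s' t, Exec p s s' t ∧ Q s' (τ + t)

section
variable {Q R : State → ℕ → Prop} {s : State} {τ : ℕ}

theorem WP.mono {p : Cmd} (h : WP p Q s τ) (hQ : ∀ s τ, Q s τ → R s τ) : WP p R s τ :=
  let ⟨s', t, he, h⟩ := h
  ⟨s', t, he, hQ _ _ h⟩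

/-- Replaces the postcondition by a variable, so that symbolic execution of a program leaves it
intact until the final state is reached. -/
theorem WP.of_forall {p : Cmd} (h : ∀ Q' : State → ℕ → Prop, (∀ s τ, Q s τ → Q' s τ) → WP p Q' s τ) :
    WP p Q s τ :=
  h Q fun _ _ h => h

@[simp] theorem wp_skip : WP .skip Q s τ ↔ Q s (τ + 1) :=
  ⟨fun ⟨_, _, he, h⟩ => by cases he; exact h, fun h => ⟨_, _, .skip s, h⟩⟩

@[simp] theorem wp_const {x k : ℕ} : WP (.const x k) Q s τ ↔ Q (s.setReg x k) (τ + 1) :=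
  ⟨fun ⟨_, _, he, h⟩ => by cases he; exact h, fun h => ⟨_, _, .const s x k, h⟩⟩

@[simp] theorem wp_copy {x y : ℕ} : WP (.copy x y) Q s τ ↔ Q (s.setReg x (s.reg y)) (τ + 1) :=
  ⟨fun ⟨_, _, he, h⟩ => by cases he; exact h, fun h => ⟨_, _, .copy s x y, h⟩⟩

@[simp] theorem wp_succ {x y : ℕ} :
    WP (.succ x y) Q s τ ↔ Q (s.setReg x (s.reg y + 1)) (τ + 1) :=
  ⟨fun ⟨_, _, he, h⟩ => by cases he; exact h, fun h => ⟨_, _, .succ s x y, h⟩⟩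

@[simp] theorem wp_sub {x y z : ℕ} :
    WP (.sub x y z) Q s τ ↔ Q (s.setReg x (s.reg y - s.reg z)) (τ + 1) :=
  ⟨fun ⟨_, _, he, h⟩ => by cases he; exact h, fun h => ⟨_, _, .sub s x y z, h⟩⟩

@[simp] theorem wp_load {x a y : ℕ} :
    WP (.load x a y) Q s τ ↔ Q (s.setReg x (s.arr a (s.reg y))) (τ + 1) :=
  ⟨fun ⟨_, _, he, h⟩ => by cases he; exact h, fun h => ⟨_, _, .load s x a y, h⟩⟩

@[simp] theorem wp_store {a x y : ℕ} :
    WP (.store a x y) Q s τ ↔ Q (s.setArr a (s.reg x) (s.reg y)) (τ + 1) :=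
  ⟨fun ⟨_, _, he, h⟩ => by cases he; exact h, fun h => ⟨_, _, .store s a x y, h⟩⟩

@[simp] theorem wp_seq {p q : Cmd} : WP (.seq p q) Q s τ ↔ WP p (WP q Q) s τ := by
  constructor
  · rintro ⟨_, _, he, h⟩
    cases he with
    | seq h₁ h₂ => exact ⟨_, _, h₁, _, _, h₂, by rwa [Nat.add_assoc]⟩
  · rintro ⟨s₁, t₁, h₁, s₂, t₂, h₂, h⟩
    exact ⟨_, _, .seq h₁ h₂, by rwa [← Nat.add_assoc]⟩

@[simp] theorem wp_ite {b : Test} {p q : Cmd} : WP (.ite b p q) Q s τ ↔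
    (b.Holds s → WP p Q s (τ + 1)) ∧ (¬ b.Holds s → WP q Q s (τ + 1)) := by
  constructor
  · rintro ⟨_, _, he, h⟩
    cases he with
    | ite_true hb he => exact ⟨fun _ => ⟨_, _, he, by rwa [Nat.add_assoc]⟩, fun hn => absurd hb hn⟩
    | ite_false hb he =>
      exact ⟨fun hn => absurd hn hb, fun _ => ⟨_, _, he, by rwa [Nat.add_assoc]⟩⟩
  · rintro ⟨h₁, h₂⟩
    by_cases hb : b.Holds s
    · obtain ⟨s', t, he, h⟩ := h₁ hb
      exact ⟨_, _, .ite_true hb he, by rwa [← Nat.add_assoc]⟩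
    · obtain ⟨s', t, he, h⟩ := h₂ hb
      exact ⟨_, _, .ite_false hb he, by rwa [← Nat.add_assoc]⟩

/-- The rule for loops: an invariant `I` that bounds the time by `T`. -/
theorem wp_while {b : Test} {p : Cmd} (I : State → ℕ → Prop) (T : ℕ) (h₀ : I s τ)
    (hT : ∀ s τ, I s τ → τ ≤ T) (hstep : ∀ s τ, I s τ → b.Holds s → WP p I s (τ + 1))
    (hend : ∀ s τ, I s τ → ¬ b.Holds s → Q s (τ + 1)) : WP (.while b p) Q s τ := by
  -- Each iteration spends at least the step of its test, so the remaining time is a variant: a time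
  -- bound on the invariant already implies termination.
  induction hd : T - τ using Nat.strong_induction_on generalizing s τ with
  | _ d ih =>
    by_cases hb : b.Holds s
    · obtain ⟨s', t, he, h⟩ := hstep s τ h₀ hb
      have h1 := hT _ _ h
      obtain ⟨s'', t', he', h'⟩ := ih (T - (τ + 1 + t)) (by omega) h rfl
      exact ⟨s'', _, .while_true hb he he', by convert h' using 1; omega⟩
    · exact ⟨s, 1, .while_false hb, hend s τ h₀ hb⟩

@[simp] theorem holds_lt {x y : ℕ} : (Test.lt x y).Holds s ↔ s.reg x < s.reg y := Iff.rfl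

@[simp] theorem holds_eq {x y : ℕ} : (Test.eq x y).Holds s ↔ s.reg x = s.reg y := Iff.rfl

@[simp] theorem setReg_reg {x k y : ℕ} :
    (s.setReg x k).reg y = if y = x then k else s.reg y := by
  simp [State.setReg, Function.update_apply]

@[simp] theorem setReg_arr {x k : ℕ} : (s.setReg x k).arr = s.arr := rfl

@[simp] theorem setArr_reg {a i k : ℕ} : (s.setArr a i k).reg = s.reg := rfl

@[simp] theorem setArr_arr {a i k b : ℕ} :
    (s.setArr a i k).arr b = if b = a then Function.update (s.arr a) i k else s.arr b := by
  simp [State.setArr, Function.update_apply]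

end

/-! ### Linked lists -/

/-- The list `l` is stored from node `h` on, in nodes `1, …, p`; the value and the successor of a
node are given by `val` and `nxt`, and `0` is the null pointer. -/
def IsList {n : ℕ} (val nxt : ℕ → ℕ) (p : ℕ) : ℕ → List (Fin n) → Prop
  | h, [] => h = 0
  | h, a :: l => 0 < h ∧ h ≤ p ∧ val h = a ∧ IsList val nxt p (nxt h) l

/-- The lists `L i` are stored from the nodes `head i` on. -/
def AreLists {n : ℕ} (val nxt : ℕ → ℕ) (p : ℕ) (head : ℕ → ℕ) (L : ℕ → List (Fin n)) : Prop :=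
  ∀ i, IsList val nxt p (head i) (L i)

section
variable {n : ℕ} {val nxt head : ℕ → ℕ} {p h : ℕ} {l : List (Fin n)} {L : ℕ → List (Fin n)}

theorem IsList.eq_nil (hl : IsList val nxt p 0 l) : l = [] := by
  cases l with
  | nil => rfl
  | cons a l => exact absurd hl.1 (lt_irrefl _)

theorem IsList.exists_cons (hl : IsList val nxt p h l) (hh : h ≠ 0) :
    ∃ a l', l = a :: l' ∧ val h = a ∧ IsList val nxt p (nxt h) l' := by
  cases l with
  | nil => exact absurd hl hh
  | cons a l => exact ⟨a, l, rfl, hl.2.2⟩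

/-- Stored lists only use nodes up to `p`, so writing the fresh node `p + 1` disturbs none. This
allows adjacency lists and buckets to share one pool of nodes. -/
theorem IsList.frame (hl : IsList val nxt p h l) (a b : ℕ) :
    IsList (Function.update val (p + 1) a) (Function.update nxt (p + 1) b) (p + 1) h l := by
  induction l generalizing h with
  | nil => exact hl
  | cons x l ih =>
    obtain ⟨h1, h2, h3, h4⟩ := hl
    have hne : h ≠ p + 1 := by omega
    refine ⟨h1, by omega, ?_, ?_⟩
    · rwa [Function.update_of_ne hne]
    · rw [Function.update_of_ne hne]
      exact ih h4

theorem AreLists.frame (hL : AreLists val nxt p head L) (a b : ℕ) :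
    AreLists (Function.update val (p + 1) a) (Function.update nxt (p + 1) b) (p + 1) head L :=
  fun i => (hL i).frame a b

theorem AreLists.push (hL : AreLists val nxt p head L) (i : ℕ) (y : Fin n) :
    AreLists (Function.update val (p + 1) y) (Function.update nxt (p + 1) (head i)) (p + 1)
      (Function.update head i (p + 1)) (Function.update L i (y :: L i)) := by
  intro j
  by_cases hj : j = i
  · subst hj
    simp only [Function.update_self, IsList]
    exact ⟨by omega, le_rfl, trivial, (hL j).frame _ _⟩
  · rw [Function.update_of_ne hj, Function.update_of_ne hj]
    exact (hL j).frame _ _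

theorem AreLists.pop (hL : AreLists val nxt p head L) {i : ℕ}
    (hl : IsList val nxt p (nxt (head i)) l) :
    AreLists val nxt p (Function.update head i (nxt (head i))) (Function.update L i l) := by
  intro j
  by_cases hj : j = i
  · subst hj
    simpa using hl
  · rw [Function.update_of_ne hj, Function.update_of_ne hj]
    exact hL j

end

/-! ### The program

Registers: `3` and `4` hold the constants `0` and `1`, and `5` the number of list nodes. Arrays: `5`
and `6` hold values and successors of list nodes, `7` the adjacency lists, `8` the buckets of
vertices of `X`, `9` the indicator of the scanned vertices, `10` the numbers `r y`, and `11` and `12`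
the vertex (plus one) that was last linked with `y` and the number of these links. -/

/-- Push register `v` on the list of index register `i` in array `a`. -/
def push (a i v : ℕ) : Cmd :=
  .seq (.succ 5 5) (.seq (.store 5 5 v) (.seq (.load 6 a i) (.seq (.store 6 5 6) (.store a i 5))))

/-- Copy the indicator of `X` to the output, and put the vertices of `X` into bucket `0`. -/
def initVertex : Cmd :=
  .seq (.load 8 2 7) (.seq (.store 3 7 8) (.seq (.ite (.eq 8 4) (push 8 3 7) .skip) (.succ 7 7)))

/-- Add the next edge to the adjacency lists. -/
def initEdge : Cmd :=
  .seq (.load 8 0 7) (.seq (.load 9 1 7) (.seq (push 7 8 9) (.seq (push 7 9 8) (.succ 7 7))))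

/-- Select the vertex in register `14`, and leave the loop over its neighbours. -/
def selectVertex : Cmd := .seq (.store 3 14 4) (.const 15 0)

/-- Treat the pair of the vertex in register `12`, which is being scanned, and the next neighbour of
the vertex in register `14`. -/
def scanPair : Cmd :=
  .seq (.load 16 5 15) (.seq (.load 15 6 15) (.seq (.load 17 9 16)
    (.ite (.eq 17 4) .skip (.seq (.load 17 10 16) (.ite (.lt 17 2)
      (.seq (.load 18 11 16) (.seq (.succ 6 12) (.ite (.eq 18 6)
        (.seq (.load 18 12 16) (.ite (.lt 18 2)
          (.seq (.succ 18 18) (.seq (.store 12 16 18) selectVertex)) .skip))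
        (.seq (.store 11 16 6) (.seq (.store 12 16 4) (.seq (.succ 17 17) (.seq (.store 10 16 17)
          (.seq (push 8 17 16) selectVertex)))))))) .skip)))))

/-- The scan of the vertex in register `12` through the next of its neighbours. -/
def scanNeighbour : Cmd :=
  .seq (.load 14 5 13) (.seq (.load 13 6 13) (.seq (.load 17 3 14)
    (.ite (.eq 17 4) .skip (.seq (.load 15 7 14) (.while (.lt 3 15) scanPair)))))

/-- The scan of the vertex in register `12`. -/
def scanVertex : Cmd :=
  .seq (.load 13 7 12) (.while (.lt 3 13) scanNeighbour)

/-- Take the next vertex from the current bucket and scan it, or go to the next lower bucket. -/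
def scanNext : Cmd :=
  .seq (.load 17 8 10) (.ite (.eq 17 3)
    (.ite (.eq 10 3) (.const 11 1) (.sub 10 10 4))
    (.seq (.load 18 6 17) (.seq (.store 8 10 18) (.seq (.load 12 5 17) (.seq (.load 18 9 12)
      (.ite (.eq 18 4) .skip (.seq (.store 9 12 4) (.seq scanVertex (.copy 10 2)))))))))

/-- Output whether both ends of the next edge are in the output vertex set. -/
def outputEdge : Cmd :=
  .seq (.load 8 0 7) (.seq (.load 9 1 7) (.seq (.load 8 3 8) (.seq (.load 9 3 9)
    (.seq (.ite (.eq 8 4) (.store 4 7 9) .skip) (.succ 7 7)))))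

/-- The algorithm. -/
def algorithm : Cmd :=
  .seq (.const 4 1) (.seq (.while (.lt 7 0) initVertex) (.seq (.const 7 0)
    (.seq (.while (.lt 7 1) initEdge) (.seq (.copy 10 2) (.seq (.while (.eq 11 3) scanNext)
      (.seq (.const 7 0) (.while (.lt 7 1) outputEdge)))))))

/-! ### Correctness of the main loop -/

theorem update_val {n : ℕ} (f : ℕ → ℕ) (v z : Fin n) (k : ℕ) :
    Function.update f v k z = if z = v then k else f z := by
  simp [Function.update_apply, Fin.ext_iff]

/-- The part of the memory that does not change after the initialization. -/
structure Static {n m : ℕ} (c : ℕ) (e : Fin m → Fin n × Fin n) (s : State) : Prop where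
  reg₀ : s.reg 0 = n
  reg₁ : s.reg 1 = m
  reg₂ : s.reg 2 = c
  reg₃ : s.reg 3 = 0
  reg₄ : s.reg 4 = 1
  arr₀ : ∀ j : Fin m, s.arr 0 j = (e j).1
  arr₁ : ∀ j : Fin m, s.arr 1 j = (e j).2

open Classical in
/-- The memory represents the scanned set `A`, the selection `sel`, the numbers `r`, and the buckets
`bkt` with `w` entries. -/
structure Core {n m : ℕ} (c : ℕ) (e : Fin m → Fin n × Fin n) (X : Finset (Fin n))
    (adj : ℕ → List (Fin n)) (A : Finset (Fin n)) (sel : Fin n → Option (Fin n × Fin n))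
    (r : Fin n → ℕ) (bkt : ℕ → List (Fin n)) (w : ℕ) (s : State) : Prop where
  static : Static c e s
  arr₃ : ∀ v : Fin n, s.arr 3 v = if v ∈ X ∨ sel v ≠ none then 1 else 0
  arr₄ : ∀ j, s.arr 4 j = 0
  adjacency : AreLists (s.arr 5) (s.arr 6) (s.reg 5) (s.arr 7) adj
  buckets : AreLists (s.arr 5) (s.arr 6) (s.reg 5) (s.arr 8) bkt
  scanned : ∀ v : Fin n, s.arr 9 v = if v ∈ A then 1 else 0
  arr₁₀ : ∀ v : Fin n, s.arr 10 v = r v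
  bkt_le : ∀ k, ∀ y ∈ bkt k, y ∈ X ∧ k ≤ r y
  mem_bkt : ∀ y ∈ X, y ∉ A → y ∈ bkt (r y)
  size : ∑ k ∈ Finset.range (c + 1), (bkt k).length = w

/-- After the scan of `x`, the vertex `v` needs no selection. -/
def Covered {n : ℕ} (c : ℕ) (X : Finset (Fin n)) (adj : ℕ → List (Fin n)) (A : Finset (Fin n))
    (x : Fin n) (sel : Fin n → Option (Fin n × Fin n)) (r : Fin n → ℕ) (v : Fin n) : Prop :=
  v ∉ X → sel v = none → ∀ y ∈ adj v, y ∉ A → y ≠ x → c ≤ r y ∨ c ≤ mult sel x y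

/-- The state during the scan of `x`, when the vertices of `l` are still to be considered. -/
structure Mid {n m : ℕ} (c : ℕ) (e : Fin m → Fin n × Fin n) (F : SimpleGraph (Fin n))
    (X : Finset (Fin n)) (adj : ℕ → List (Fin n)) (A : Finset (Fin n)) (x : Fin n)
    (sel₀ : Fin n → Option (Fin n × Fin n)) (r₀ : Fin n → ℕ)
    (D : Fin n → Prop) (l : List (Fin n)) (sel : Fin n → Option (Fin n × Fin n)) (r : Fin n → ℕ)
    (bkt : ℕ → List (Fin n)) (w : ℕ) (s : State) : Prop where
  core : Core c e X adj (insert x A) sel r bkt w s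
  scan : Scan F X c A x sel₀ r₀ sel r
  stamp : ∀ y : Fin n, s.arr 11 y = x + 1 ↔ mult sel x y ≠ 0
  arr₁₂ : ∀ y : Fin n, mult sel x y ≠ 0 → s.arr 12 y = mult sel x y
  stamp_old : ∀ y z : Fin n, z ∉ insert x A → s.arr 11 y ≠ z + 1
  reg₁₁ : s.reg 11 = 0
  reg₁₂ : s.reg 12 = x
  list : IsList (s.arr 5) (s.arr 6) (s.reg 5) (s.reg 13) l
  list_sub : ∀ v ∈ l, v ∈ adj x
  covered : ∀ v, D v → Covered c X adj A x sel r v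

/-- The state in the loop over the neighbours of `v`, when those in `l'` are still to be
considered. -/
structure Inner {n m : ℕ} (c : ℕ) (e : Fin m → Fin n × Fin n) (F : SimpleGraph (Fin n))
    (X : Finset (Fin n)) (adj : ℕ → List (Fin n)) (A : Finset (Fin n)) (x : Fin n)
    (sel₀ : Fin n → Option (Fin n × Fin n)) (r₀ : Fin n → ℕ)
    (D : Fin n → Prop) (l : List (Fin n)) (v : Fin n) (l' : List (Fin n))
    (sel : Fin n → Option (Fin n × Fin n)) (r : Fin n → ℕ)
    (bkt : ℕ → List (Fin n)) (w : ℕ) (s : State) : Prop where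
  mid : Mid c e F X adj A x sel₀ r₀ D l sel r bkt w s
  reg₁₄ : s.reg 14 = v
  list' : IsList (s.arr 5) (s.arr 6) (s.reg 5) (s.reg 15) l'
  list'_sub : ∀ y ∈ l', y ∈ adj v
  eq_nil : sel v ≠ none → l' = []
  covered' : sel v = none → ∀ y ∈ adj v, y ∉ l' → y ∉ A → y ≠ x → c ≤ r y ∨ c ≤ mult sel x y

theorem sum_length_push {n c k : ℕ} (hk : k ≤ c) (bkt : ℕ → List (Fin n)) (y : Fin n) :
    ∑ i ∈ Finset.range (c + 1), (Function.update bkt k (y :: bkt k) i).length =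
      ∑ i ∈ Finset.range (c + 1), (bkt i).length + 1 := by
  have hk : k ∈ Finset.range (c + 1) := Finset.mem_range.2 (by omega)
  rw [← Finset.add_sum_erase _ _ hk, ← Finset.add_sum_erase _ _ hk,
    Finset.sum_congr rfl (g := fun i => (bkt i).length)]
  · simp
    omega
  · intro i hi
    rw [Function.update_of_ne (Finset.ne_of_mem_erase hi)]

section
variable {n m c : ℕ} {e : Fin m → Fin n × Fin n} {F : SimpleGraph (Fin n)}
  {X A : Finset (Fin n)} {adj bkt : ℕ → List (Fin n)} {x v y : Fin n}
  {sel₀ sel : Fin n → Option (Fin n × Fin n)} {r₀ r : Fin n → ℕ} {D : Fin n → Prop}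
  {l l' : List (Fin n)} {w : ℕ} {s : State}

/-- Selections only increase `r` and `mult`, so both alternatives persist. -/
theorem Covered.select (h : Covered c X adj A x sel r v) {u : Fin n} (hu : sel u = none)
    {k : ℕ} (hk : r y ≤ k) :
    Covered c X adj A x (Function.update sel u (some (x, y))) (Function.update r y k) v := by
  intro hv hs z hz hzA hzx
  have hvu : v ≠ u := by
    rintro rfl
    simp at hs
  rw [Function.update_of_ne hvu] at hs
  rw [mult_update hu]
  refine (h hv hs z hz hzA hzx).imp (fun h => h.trans ?_) fun h => h.trans (by omega)
  by_cases hzy : z = y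
  · subst hzy
    simpa
  · rw [Function.update_of_ne hzy]

theorem Static.congr {s' : State} (h : Static c e s) (ha : s'.arr = s.arr)
    (hr : ∀ i ≤ 5, s'.reg i = s.reg i) : Static c e s' := by
  refine ⟨?_, ?_, ?_, ?_, ?_, ?_, ?_⟩
  · rw [hr 0 (by omega), h.reg₀]
  · rw [hr 1 (by omega), h.reg₁]
  · rw [hr 2 (by omega), h.reg₂]
  · rw [hr 3 (by omega), h.reg₃]
  · rw [hr 4 (by omega), h.reg₄]
  · rw [ha]
    exact h.arr₀
  · rw [ha]
    exact h.arr₁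

theorem Core.congr {s' : State} (h : Core c e X adj A sel r bkt w s) (ha : s'.arr = s.arr)
    (hr : ∀ i ≤ 5, s'.reg i = s.reg i) : Core c e X adj A sel r bkt w s' := by
  obtain ⟨h1, h2, h3, h4, h5, h6, h7, h8, h9, h10⟩ := h
  refine ⟨h1.congr ha hr, ?_, ?_, ?_, ?_, ?_, ?_, h8, h9, h10⟩ <;>
    simpa only [ha, hr 5 le_rfl]

theorem Mid.congr {s' : State} (h : Mid c e F X adj A x sel₀ r₀ D l sel r bkt w s)
    (ha : s'.arr = s.arr) (hr : ∀ i ≤ 5, s'.reg i = s.reg i) (h₁₁ : s'.reg 11 = s.reg 11)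
    (h₁₂ : s'.reg 12 = s.reg 12) (h₁₃ : s'.reg 13 = s.reg 13) :
    Mid c e F X adj A x sel₀ r₀ D l sel r bkt w s' := by
  obtain ⟨h1, h2, h3, h4, h5, h6, h7, h8, h9, h10⟩ := h
  refine ⟨h1.congr ha hr, h2, ?_, ?_, ?_, ?_, ?_, ?_, h9, h10⟩ <;>
    simpa only [ha, hr 5 le_rfl, h₁₁, h₁₂, h₁₃]

theorem Inner.skip {s' : State} (h : Inner c e F X adj A x sel₀ r₀ D l v (y :: l') sel r bkt w s)
    (ha : s'.arr = s.arr) (hr : ∀ i ≤ 5, s'.reg i = s.reg i) (h₁₁ : s'.reg 11 = s.reg 11)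
    (h₁₂ : s'.reg 12 = s.reg 12) (h₁₃ : s'.reg 13 = s.reg 13) (h₁₄ : s'.reg 14 = s.reg 14)
    (h₁₅ : s'.reg 15 = s.arr 6 (s.reg 15))
    (hy : y ∈ insert x A ∨ c ≤ r y ∨ c ≤ mult sel x y) :
    Inner c e F X adj A x sel₀ r₀ D l v l' sel r bkt w s' := by
  obtain ⟨h1, h2, h3, h4, h5, h6⟩ := h
  refine ⟨h1.congr ha hr h₁₁ h₁₂ h₁₃, ?_, ?_, ?_, ?_, ?_⟩
  · rw [h₁₄, h2]
  · rw [ha, hr 5 le_rfl, h₁₅]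
    exact h3.2.2.2
  · exact fun z hz => h4 z (by simp [hz])
  · exact fun hn => absurd (h5 hn) (by simp)
  · intro hsel z hz hzl hzA hzx
    by_cases hzy : z = y
    · subst hzy
      simpa [hzA, hzx] using hy
    · exact h6 hsel z hz (by simp [hzy, hzl]) hzA hzx

/-- A further link between the same `x` and `y`: only the counter of `y` grows, while `r` and the
buckets stay as they are. -/
theorem Inner.step_select_again
    (h : Inner c e F X adj A x sel₀ r₀ D l v (y :: l') sel r bkt w s) (hv : v ∉ X)
    (hvx : F.Adj v x) (hvy : F.Adj v y) (hyX : y ∈ X) (hyA : y ∉ insert x A) (hrc : r y < c)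
    (hm : mult sel x y ≠ 0) (hmc : mult sel x y < c) {s' : State}
    (ha : s'.arr = ((s.setArr 12 y (s.arr 12 y + 1)).setArr 3 v 1).arr)
    (hr : ∀ i ≤ 5, s'.reg i = s.reg i) (h₁₁ : s'.reg 11 = s.reg 11)
    (h₁₂ : s'.reg 12 = s.reg 12) (h₁₃ : s'.reg 13 = s.reg 13) (h₁₄ : s'.reg 14 = s.reg 14)
    (h₁₅ : s'.reg 15 = 0) :
    Inner c e F X adj A x sel₀ r₀ D l v [] (Function.update sel v (some (x, y))) r bkt w s' := by
  have hsel : sel v = none := by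
    by_contra hn
    simpa using h.eq_nil hn
  have hM := h.mid
  have hC := hM.core
  have hS := hC.static
  have hyA' := hyA
  simp only [Finset.mem_insert, not_or] at hyA'
  have hsc := hM.scan.select hsel hv hvx hvy hyX hyA'.2 hyA'.1 hrc hmc
  rw [if_neg hm, Function.update_eq_self] at hsc
  have hr5 := hr 5 le_rfl
  refine ⟨⟨⟨⟨?_, ?_, ?_, ?_, ?_, ?_, ?_⟩, ?_, ?_, ?_, ?_, ?_, ?_, hC.bkt_le, hC.mem_bkt, hC.size⟩,
    hsc, ?_, ?_, ?_, ?_, ?_, ?_, hM.list_sub, ?_⟩, ?_, h₁₅, by simp, fun _ => rfl, ?_⟩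
  · rw [hr 0 (by omega), hS.reg₀]
  · rw [hr 1 (by omega), hS.reg₁]
  · rw [hr 2 (by omega), hS.reg₂]
  · rw [hr 3 (by omega), hS.reg₃]
  · rw [hr 4 (by omega), hS.reg₄]
  · simpa [ha] using hS.arr₀
  · simpa [ha] using hS.arr₁
  · intro z
    by_cases hz : z = v
    · simp [ha, hz]
    · simpa [ha, update_val, hz] using hC.arr₃ z
  · simpa [ha] using hC.arr₄
  · simpa [ha, hr5] using hC.adjacency
  · simpa [ha, hr5] using hC.buckets
  · simpa [ha] using hC.scanned
  · simpa [ha] using hC.arr₁₀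
  · intro z
    rw [mult_update hsel]
    by_cases hz : z = y
    · subst hz
      simp [ha, (hM.stamp z).2 hm]
    · simpa [ha, hz] using hM.stamp z
  · intro z
    rw [mult_update hsel]
    by_cases hz : z = y
    · subst hz
      simp [ha, hM.arr₁₂ z hm]
    · simpa [ha, update_val, hz] using hM.arr₁₂ z
  · simpa [ha] using hM.stamp_old
  · rw [h₁₁, hM.reg₁₁]
  · rw [h₁₂, hM.reg₁₂]
  · simpa [ha, hr5, h₁₃] using hM.list
  · intro u hu
    have := (hM.covered u hu).select hsel (y := y) le_rfl
    rwa [Function.update_eq_self] at this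
  · rw [h₁₄, h.reg₁₄]
  · simp

/-- The first link of `x` with `y` raises `r y`, so `y` enters the next bucket. Its old entry is
left behind, which is why `bkt_le` asks only for `k ≤ r y`. The stamp `x + 1` restarts the counter
of `y` without any clearing between scans; the shift by one keeps the initial 0 from naming a
vertex. -/
theorem Inner.step_select_first
    (h : Inner c e F X adj A x sel₀ r₀ D l v (y :: l') sel r bkt w s) (hv : v ∉ X)
    (hvx : F.Adj v x) (hvy : F.Adj v y) (hyX : y ∈ X) (hyA : y ∉ insert x A) (hrc : r y < c)
    (hm : mult sel x y = 0) {s' : State}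
    (ha : s'.arr = (((((((s.setArr 11 y (x + 1)).setArr 12 y 1).setArr 10 y (r y + 1)).setArr 5
      (s.reg 5 + 1) y).setArr 6 (s.reg 5 + 1) (s.arr 8 (r y + 1))).setArr 8 (r y + 1)
      (s.reg 5 + 1)).setArr 3 v 1).arr)
    (hr : ∀ i < 5, s'.reg i = s.reg i) (hr5 : s'.reg 5 = s.reg 5 + 1)
    (h₁₁ : s'.reg 11 = s.reg 11)
    (h₁₂ : s'.reg 12 = s.reg 12) (h₁₃ : s'.reg 13 = s.reg 13) (h₁₄ : s'.reg 14 = s.reg 14)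
    (h₁₅ : s'.reg 15 = 0) :
    Inner c e F X adj A x sel₀ r₀ D l v [] (Function.update sel v (some (x, y)))
      (Function.update r y (r y + 1))
      (Function.update bkt (r y + 1) (y :: bkt (r y + 1))) (w + 1) s' := by
  have hsel : sel v = none := by
    by_contra hn
    simpa using h.eq_nil hn
  have hM := h.mid
  have hC := hM.core
  have hS := hC.static
  have hyA' := hyA
  simp only [Finset.mem_insert, not_or] at hyA'
  have hsc := hM.scan.select hsel hv hvx hvy hyX hyA'.2 hyA'.1 hrc (by omega)
  rw [if_pos hm] at hsc
  refine ⟨⟨⟨⟨?_, ?_, ?_, ?_, ?_, ?_, ?_⟩, ?_, ?_, ?_, ?_, ?_, ?_, ?_, ?_, ?_⟩,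
    hsc, ?_, ?_, ?_, ?_, ?_, ?_, hM.list_sub, ?_⟩, ?_, h₁₅, by simp, fun _ => rfl, ?_⟩
  · rw [hr 0 (by omega), hS.reg₀]
  · rw [hr 1 (by omega), hS.reg₁]
  · rw [hr 2 (by omega), hS.reg₂]
  · rw [hr 3 (by omega), hS.reg₃]
  · rw [hr 4 (by omega), hS.reg₄]
  · simpa [ha] using hS.arr₀
  · simpa [ha] using hS.arr₁
  · intro z
    by_cases hz : z = v
    · simp [ha, hz]
    · simpa [ha, update_val, hz] using hC.arr₃ z
  · simpa [ha] using hC.arr₄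
  · simpa [ha, hr5] using hC.adjacency.frame y (s.arr 8 (r y + 1))
  · simpa [ha, hr5] using hC.buckets.push (r y + 1) y
  · simpa [ha] using hC.scanned
  · intro z
    by_cases hz : z = y
    · subst hz
      simp [ha]
    · simpa [ha, update_val, hz] using hC.arr₁₀ z
  · intro k z hz
    have hz' : z = y ∧ k = r y + 1 ∨ z ∈ bkt k := by
      by_cases hk : k = r y + 1
      · subst hk
        simpa using hz
      · rw [Function.update_of_ne hk] at hz
        exact Or.inr hz
    by_cases hzy : z = y
    · subst hzy
      rw [Function.update_self]
      rcases hz' with ⟨-, rfl⟩ | hz'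
      · exact ⟨hyX, le_rfl⟩
      · exact ⟨hyX, (hC.bkt_le k z hz').2.trans (by omega)⟩
    · rw [Function.update_of_ne hzy]
      exact hC.bkt_le k z (hz'.resolve_left fun h => hzy h.1)
  · intro z hzX hzA
    by_cases hzy : z = y
    · subst hzy
      simp
    · rw [Function.update_of_ne hzy]
      have := hC.mem_bkt z hzX hzA
      by_cases hk : r z = r y + 1
      · rw [hk] at this ⊢
        simp [this]
      · rwa [Function.update_of_ne hk]
  · rw [sum_length_push (by omega), hC.size]
  · intro z
    rw [mult_update hsel]
    by_cases hz : z = y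
    · subst hz
      simp [ha]
    · simpa [ha, hz, update_val] using hM.stamp z
  · intro z
    rw [mult_update hsel]
    by_cases hz : z = y
    · subst hz
      simp [ha, hm]
    · simpa [ha, update_val, hz] using hM.arr₁₂ z
  · intro z u hu
    by_cases hz : z = y
    · subst hz
      have : x ≠ u := by
        rintro rfl
        simp at hu
      simpa [ha, Fin.val_inj] using this
    · simpa [ha, update_val, hz] using hM.stamp_old z u hu
  · rw [h₁₁, hM.reg₁₁]
  · rw [h₁₂, hM.reg₁₂]
  · simpa [ha, hr5, h₁₃] using hM.list.frame y (s.arr 8 (r y + 1))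
  · exact fun u hu => (hM.covered u hu).select hsel (by omega)
  · rw [h₁₄, h.reg₁₄]
  · simp

theorem Inner.step (h : Inner c e F X adj A x sel₀ r₀ D l v l' sel r bkt w s)
    (hadj : ∀ u z : Fin n, z ∈ adj u ↔ F.Adj u z) (hF : F.IsVertexCover (X : Set (Fin n)))
    (hv : v ∉ X) (hvx : F.Adj v x) (hs : s.reg 15 ≠ 0) {τ : ℕ} :
    WP scanPair (fun s' τ' => ∃ sel' r' bkt' w' l'',
      Inner c e F X adj A x sel₀ r₀ D l v l'' sel' r' bkt' w' s' ∧
        τ' ≤ τ + 30 ∧ w' ≤ w + 1 ∧ l''.length + 1 ≤ l'.length) s τ := by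
  obtain ⟨y, l'', rfl, hy, hl''⟩ := h.list'.exists_cons hs
  have hM := h.mid
  have hC := hM.core
  have hS := hC.static
  have hvy : F.Adj v y := (hadj v y).1 (h.list'_sub y (by simp))
  have hyX : y ∈ X := (hF hvy).resolve_left hv
  -- The vertex `x` is marked as scanned before its scan starts, so one test excludes both `x` and
  -- the elements of `A`.
  by_cases hyA : y ∈ insert x A
  · simp [scanPair, hy, hS.reg₄, hC.scanned, hyA]
    refine ⟨sel, r, bkt, w, l'', h.skip rfl ?_ ?_ ?_ ?_ ?_ ?_ (Or.inl hyA), by omega, le_rfl⟩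
    · intro i hi
      interval_cases i <;> simp
    all_goals simp
  by_cases hrc : r y < c
  swap
  · simp [scanPair, hy, hS.reg₄, hS.reg₂, hC.scanned, hC.arr₁₀, hyA, hrc]
    refine ⟨sel, r, bkt, w, l'', h.skip rfl ?_ ?_ ?_ ?_ ?_ ?_ (Or.inr (Or.inl (by omega))),
      by omega, le_rfl⟩
    · intro i hi
      interval_cases i <;> simp
    all_goals simp
  simp [scanPair, hyA, hrc, hM.stamp, hy, hS.reg₄, hS.reg₂, hC.scanned, hC.arr₁₀, hM.reg₁₂,
    selectVertex, push]
  refine ⟨fun hm => ⟨fun hmc => ?_, fun hmc => ?_⟩, fun hm => ?_⟩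
  · rw [hM.arr₁₂ y hm] at hmc
    refine ⟨_, _, _, w, [], h.step_select_again hv hvx hvy hyX hyA hrc hm hmc ?_ ?_ ?_ ?_ ?_ ?_ ?_,
      by omega, by simp⟩
    · funext i
      simp [h.reg₁₄]
    · intro i hi
      interval_cases i <;> simp
    all_goals simp
  · rw [hM.arr₁₂ y hm] at hmc
    refine ⟨sel, r, bkt, w, l'', h.skip rfl ?_ ?_ ?_ ?_ ?_ ?_ (Or.inr (Or.inr hmc)),
      by omega, le_rfl⟩
    · intro i hi
      interval_cases i <;> simp
    all_goals simp
  · refine ⟨_, _, _, w + 1, [], h.step_select_first hv hvx hvy hyX hyA hrc hm ?_ ?_ ?_ ?_ ?_ ?_ ?_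
      ?_, by omega, by simp⟩
    · funext i
      simp [h.reg₁₄]
    · intro i hi
      interval_cases i <;> simp
    all_goals simp

end

/-! ### The three nested loops and their time bounds. -/

section
variable {n m c : ℕ} {e : Fin m → Fin n × Fin n} {F : SimpleGraph (Fin n)}
  {X A : Finset (Fin n)} {adj bkt : ℕ → List (Fin n)} {x v y : Fin n}
  {sel₀ sel : Fin n → Option (Fin n × Fin n)} {r₀ r : Fin n → ℕ} {D : Fin n → Prop}
  {l l' : List (Fin n)} {w Δ : ℕ} {s : State} {τ : ℕ}

theorem Mid.weaken (h : Mid c e F X adj A x sel₀ r₀ D l sel r bkt w s) {D' : Fin n → Prop}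
    (hD : ∀ v, D' v → D v) : Mid c e F X adj A x sel₀ r₀ D' l sel r bkt w s :=
  { h with covered := fun v hv => h.covered v (hD v hv) }

/-- An iteration costs 30 steps and 1 for the test, adds at most one bucket entry and shortens the
list; a selection empties the list at once. -/
theorem Inner.loop (h : Inner c e F X adj A x sel₀ r₀ D l v l' sel r bkt w s)
    (hadj : ∀ u z : Fin n, z ∈ adj u ↔ F.Adj u z) (hF : F.IsVertexCover (X : Set (Fin n)))
    (hv : v ∉ X) (hvx : F.Adj v x) :
    WP (.while (.lt 3 15) scanPair) (fun s' τ' => ∃ sel' r' bkt' w',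
      Mid c e F X adj A x sel₀ r₀ (fun u => D u ∨ u = v) l sel' r' bkt' w' s' ∧
        τ' ≤ τ + 31 * l'.length + 1 ∧ w' ≤ w + l'.length) s τ := by
  refine wp_while (fun s' τ' => ∃ sel' r' bkt' w' l'',
    Inner c e F X adj A x sel₀ r₀ D l v l'' sel' r' bkt' w' s' ∧
      τ' + 31 * l''.length ≤ τ + 31 * l'.length ∧ w' + l''.length ≤ w + l'.length)
    (τ + 31 * l'.length) ⟨sel, r, bkt, w, l', h, le_rfl, le_rfl⟩ ?_ ?_ ?_
  · rintro s' τ' ⟨_, _, _, _, _, -, h, -⟩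
    omega
  · rintro s' τ' ⟨sel', r', bkt', w', l'', h, hτ, hw⟩ hs
    rw [holds_lt] at hs
    refine (h.step hadj hF hv hvx (by omega)).mono ?_
    rintro s₂ τ₂ ⟨sel₂, r₂, bkt₂, w₂, l₂, h₂, hτ₂, hw₂, hl₂⟩
    exact ⟨sel₂, r₂, bkt₂, w₂, l₂, h₂, by omega, by omega⟩
  · rintro s' τ' ⟨sel', r', bkt', w', l'', h, hτ, hw⟩ hs
    rw [holds_lt, h.mid.core.static.reg₃, not_lt, Nat.le_zero] at hs
    have hl := h.list'
    rw [hs] at hl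
    obtain rfl := hl.eq_nil
    refine ⟨sel', r', bkt', w', ⟨h.mid.core, h.mid.scan, h.mid.stamp, h.mid.arr₁₂, h.mid.stamp_old,
      h.mid.reg₁₁, h.mid.reg₁₂, h.mid.list, h.mid.list_sub, ?_⟩, by omega, by simpa using hw⟩
    rintro u (hu | rfl)
    · exact h.mid.covered u hu
    · exact fun _ hsel z hz hzA hzx => h.covered' hsel z hz (by simp) hzA hzx

theorem Mid.step (h : Mid c e F X adj A x sel₀ r₀ D l sel r bkt w s)
    (hadj : ∀ u z : Fin n, z ∈ adj u ↔ F.Adj u z) (hF : F.IsVertexCover (X : Set (Fin n)))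
    (hΔ : ∀ v : Fin n, v ∉ X → (adj v).length ≤ Δ) (hs : s.reg 13 ≠ 0) :
    WP scanNeighbour (fun s' τ' => ∃ sel' r' bkt' w' v l'', l = v :: l'' ∧
      Mid c e F X adj A x sel₀ r₀ (fun u => D u ∨ u = v) l'' sel' r' bkt' w' s' ∧
        τ' ≤ τ + 31 * Δ + 6 ∧ w' ≤ w + Δ) s τ := by
  obtain ⟨v, l'', rfl, hv, hl''⟩ := h.list.exists_cons hs
  have hC := h.core
  have hS := hC.static
  have hsub : ∀ z ∈ l'', z ∈ adj x := fun z hz => h.list_sub z (by simp [hz])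
  have hM : Mid c e F X adj A x sel₀ r₀ D l'' sel r bkt w
      ((s.setReg 14 v).setReg 13 (s.arr 6 (s.reg 13))) := by
    refine ⟨hC.congr rfl ?_, h.scan, h.stamp, h.arr₁₂, h.stamp_old, ?_, ?_, ?_, hsub, h.covered⟩
    · intro i hi
      interval_cases i <;> simp
    · simpa using h.reg₁₁
    · simpa using h.reg₁₂
    · simpa using hl''
  refine WP.of_forall fun Q hQ => ?_
  by_cases hvX : v ∈ X ∨ sel v ≠ none
  · have := hC.arr₃ v
    rw [if_pos hvX] at this
    simp [scanNeighbour, hv, hS.reg₄, this]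
    refine hQ _ _ ⟨sel, r, bkt, w, v, l'', rfl, ?_, by omega, by omega⟩
    have hM' : Mid c e F X adj A x sel₀ r₀ (fun u => D u ∨ u = v) l'' sel r bkt w
        ((s.setReg 14 v).setReg 13 (s.arr 6 (s.reg 13))) := by
      refine { hM with covered := ?_ }
      rintro u (hu | rfl)
      · exact h.covered u hu
      · intro hu hsel
        tauto
    refine hM'.congr rfl ?_ ?_ ?_ ?_
    · intro i hi
      interval_cases i <;> simp
    all_goals simp
  · have := hC.arr₃ v
    rw [if_neg hvX] at this
    rw [not_or, not_not] at hvX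
    simp [scanNeighbour, hv, hS.reg₄, this]
    have hvx : F.Adj v x := ((hadj x v).1 (h.list_sub v (by simp))).symm
    refine WP.mono (Inner.loop (D := D) (v := v) (l := l'') (l' := adj v) (sel := sel) (r := r)
      (bkt := bkt) (w := w) (sel₀ := sel₀) (r₀ := r₀) (A := A) (e := e)
      ⟨hM.congr rfl ?_ ?_ ?_ ?_, ?_, ?_, fun _ h => h, fun hn => absurd hvX.2 hn, ?_⟩
      hadj hF hvX.1 hvx) ?_
    · intro i hi
      interval_cases i <;> simp
    · simp
    · simp
    · simp
    · simp
    · simpa using hC.adjacency v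
    · exact fun _ z hz hzn => absurd hz hzn
    · rintro s' τ' ⟨sel', r', bkt', w', h', hτ', hw'⟩
      have := hΔ v hvX.1
      exact hQ _ _ ⟨sel', r', bkt', w', v, l'', rfl, h', by omega, by omega⟩

theorem Mid.loop (h : Mid c e F X adj A x sel₀ r₀ (fun _ => False) (adj x) sel r bkt w s)
    (hadj : ∀ u z : Fin n, z ∈ adj u ↔ F.Adj u z) (hF : F.IsVertexCover (X : Set (Fin n)))
    (hΔ : ∀ v : Fin n, v ∉ X → (adj v).length ≤ Δ) :
    WP (.while (.lt 3 13) scanNeighbour) (fun s' τ' => ∃ sel' r' bkt' w',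
      Mid c e F X adj A x sel₀ r₀ (· ∈ adj x) [] sel' r' bkt' w' s' ∧
        τ' ≤ τ + (31 * Δ + 7) * (adj x).length + 1 ∧ w' ≤ w + Δ * (adj x).length) s τ := by
  refine wp_while (fun s' τ' => ∃ sel' r' bkt' w' l,
    Mid c e F X adj A x sel₀ r₀ (fun u => u ∈ adj x ∧ u ∉ l) l sel' r' bkt' w' s' ∧
      τ' + (31 * Δ + 7) * l.length ≤ τ + (31 * Δ + 7) * (adj x).length ∧
      w' + Δ * l.length ≤ w + Δ * (adj x).length)
    (τ + (31 * Δ + 7) * (adj x).length)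
    ⟨sel, r, bkt, w, adj x, h.weaken (by simp), le_rfl, le_rfl⟩ ?_ ?_ ?_
  · rintro s' τ' ⟨_, _, _, _, _, -, h, -⟩
    omega
  · rintro s' τ' ⟨sel', r', bkt', w', l, h, hτ, hw⟩ hs
    rw [holds_lt] at hs
    refine (h.step hadj hF hΔ (by omega)).mono ?_
    rintro s₂ τ₂ ⟨sel₂, r₂, bkt₂, w₂, v, l₂, rfl, h₂, hτ₂, hw₂⟩
    rw [List.length_cons, Nat.mul_add] at hτ hw
    refine ⟨sel₂, r₂, bkt₂, w₂, l₂, h₂.weaken ?_, by omega, by omega⟩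
    rintro u ⟨hu, hul⟩
    by_cases huv : u = v
    · exact Or.inr huv
    · exact Or.inl ⟨hu, by simp [huv, hul]⟩
  · rintro s' τ' ⟨sel', r', bkt', w', l, h, hτ, hw⟩ hs
    rw [holds_lt, h.core.static.reg₃, not_lt, Nat.le_zero] at hs
    have hl := h.list
    rw [hs] at hl
    obtain rfl := hl.eq_nil
    exact ⟨sel', r', bkt', w', h.weaken (by simp), by omega, by simpa using hw⟩

/-- The state in the main loop. -/
structure Main {n m : ℕ} (c : ℕ) (e : Fin m → Fin n × Fin n) (F : SimpleGraph (Fin n))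
    (X : Finset (Fin n)) (adj : ℕ → List (Fin n)) (A : Finset (Fin n))
    (sel : Fin n → Option (Fin n × Fin n)) (r : Fin n → ℕ) (bkt : ℕ → List (Fin n)) (w k : ℕ)
    (s : State) : Prop where
  core : Core c e X adj A sel r bkt w s
  inv : Inv F X c A sel r
  stamp : ∀ y z : Fin n, z ∉ A → s.arr 11 y ≠ z + 1
  reg₁₀ : s.reg 10 = k
  le : k ≤ c
  eq_nil : ∀ k', k < k' → bkt k' = []

theorem sum_length_pop {n c k : ℕ} (hk : k ≤ c) (bkt : ℕ → List (Fin n)) (y : Fin n)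
    {l : List (Fin n)} (hl : bkt k = y :: l) :
    ∑ i ∈ Finset.range (c + 1), (Function.update bkt k l i).length + 1 =
      ∑ i ∈ Finset.range (c + 1), (bkt i).length := by
  have := sum_length_push hk (Function.update bkt k l) y
  rw [Function.update_self, Function.update_idem, ← hl, Function.update_eq_self] at this
  exact this.symm

theorem Core.pop (h : Core c e X adj A sel r bkt w s) {k : ℕ} (hk : k ≤ c)
    (hb : bkt k = x :: l) (hl : IsList (s.arr 5) (s.arr 6) (s.reg 5) (s.arr 6 (s.arr 8 k)) l)
    {A' : Finset (Fin n)} (hA : A ⊆ A') (hx : x ∈ A') {s' : State}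
    (hr : ∀ i ≤ 5, s'.reg i = s.reg i) (ha : ∀ i < 8, s'.arr i = s.arr i)
    (h₈ : s'.arr 8 = Function.update (s.arr 8) k (s.arr 6 (s.arr 8 k)))
    (h₉ : ∀ v : Fin n, s'.arr 9 v = if v ∈ A' then 1 else 0) (h₁₀ : s'.arr 10 = s.arr 10) :
    Core c e X adj A' sel r (Function.update bkt k l) (w - 1) s' := by
  have hS := h.static
  refine ⟨⟨?_, ?_, ?_, ?_, ?_, ?_, ?_⟩, ?_, ?_, ?_, ?_, h₉, ?_, ?_, ?_, ?_⟩
  · rw [hr 0 (by omega), hS.reg₀]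
  · rw [hr 1 (by omega), hS.reg₁]
  · rw [hr 2 (by omega), hS.reg₂]
  · rw [hr 3 (by omega), hS.reg₃]
  · rw [hr 4 (by omega), hS.reg₄]
  · simpa [ha] using hS.arr₀
  · simpa [ha] using hS.arr₁
  · simpa [ha] using h.arr₃
  · simpa [ha] using h.arr₄
  · simpa [ha, hr] using h.adjacency
  · simpa [ha, hr, h₈] using h.buckets.pop hl
  · simpa [h₁₀] using h.arr₁₀
  · intro i y hy
    refine h.bkt_le i y ?_
    by_cases hi : i = k
    · subst hi
      rw [Function.update_self] at hy
      simp [hb, hy]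
    · rwa [Function.update_of_ne hi] at hy
  · intro y hy hyA
    have := h.mem_bkt y hy fun h => hyA (hA h)
    by_cases hi : r y = k
    · rw [hi, Function.update_self]
      rw [hi, hb, List.mem_cons] at this
      refine this.resolve_left ?_
      rintro rfl
      exact hyA hx
    · rwa [Function.update_of_ne hi]
  · have := sum_length_pop hk bkt x hb
    rw [h.size] at this
    omega

set_option maxHeartbeats 1000000 in
-- Every unscanned `y` has an entry in bucket `r y`, and the buckets above `k` are empty, so an
-- unscanned vertex popped from bucket `k` has the greatest `r`. Entries of scanned vertices are
-- thrown away when met. The three outcomes are a decrease of `w + k`, the end of the search, and a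
-- scan.
theorem Main.step {k : ℕ} (h : Main c e F X adj A sel r bkt w k s)
    (hadj : ∀ u z : Fin n, z ∈ adj u ↔ F.Adj u z) (hF : F.IsVertexCover (X : Set (Fin n)))
    (hΔ : ∀ v : Fin n, v ∉ X → (adj v).length ≤ Δ) (h₁₁ : s.reg 11 = 0) :
    WP scanNext (fun s' τ' => ∃ A' sel' r' bkt' w' k',
      Main c e F X adj A' sel' r' bkt' w' k' s' ∧
      ((A' = A ∧ s'.reg 11 = 0 ∧ w' + k' + 1 ≤ w + k ∧ τ' ≤ τ + 8) ∨
      (A' = X ∧ A = X ∧ s'.reg 11 = 1 ∧ w' + k' ≤ w + k ∧ τ' ≤ τ + 4) ∨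
      ∃ x ∈ X, x ∉ A ∧ A' = insert x A ∧ s'.reg 11 = 0 ∧ k' = c ∧
        w' ≤ w + Δ * (adj x).length ∧ τ' ≤ τ + (31 * Δ + 7) * (adj x).length + 11)) s τ := by
  have hC := h.core
  have hS := hC.static
  have hB := hC.buckets k
  have h₁₀ := h.reg₁₀
  refine WP.of_forall fun Q hQ => ?_
  by_cases hk : s.arr 8 k = 0
  · rw [hk] at hB
    have hnil := hB.eq_nil
    by_cases hk0 : k = 0
    · subst hk0
      simp [scanNext, h₁₀, hk, hS.reg₃]
      have hAX : A = X := by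
        refine Finset.Subset.antisymm h.inv.sub fun y hy => ?_
        by_contra hyA
        have := hC.mem_bkt y hy hyA
        rcases Nat.eq_zero_or_pos (r y) with h0 | h0
        · simp [h0, hnil] at this
        · simp [h.eq_nil _ h0] at this
      refine hQ _ _ ⟨A, sel, r, bkt, w, 0, ⟨hC.congr rfl ?_, h.inv, h.stamp, by simp [h₁₀], h.le,
        h.eq_nil⟩, Or.inr (Or.inl ⟨hAX, hAX, by simp, by omega, by omega⟩)⟩
      intro i hi
      interval_cases i <;> simp
    · simp [scanNext, h₁₀, hk, hS.reg₃, hS.reg₄, hk0]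
      refine hQ _ _ ⟨A, sel, r, bkt, w, k - 1, ⟨hC.congr rfl ?_, h.inv, h.stamp, by simp,
        by have := h.le; omega, ?_⟩, Or.inl ⟨rfl, by simpa using h₁₁, by omega, by omega⟩⟩
      · intro i hi
        interval_cases i <;> simp
      · intro k' hk'
        rcases (show k = k' ∨ k < k' by omega) with rfl | hlt
        · exact hnil
        · exact h.eq_nil k' hlt
  obtain ⟨x, l, hb, hx, hl⟩ := hB.exists_cons hk
  have hxb := hC.bkt_le k x (by simp [hb])
  have hnil : ∀ k', k < k' → Function.update bkt k l k' = [] := by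
    intro k' hk'
    rw [Function.update_of_ne (by omega)]
    exact h.eq_nil k' hk'
  have hw : 1 ≤ w := by
    have := sum_length_pop h.le bkt x hb
    rw [hC.size] at this
    omega
  by_cases hxA : x ∈ A
  · simp [scanNext, h₁₀, hk, hS.reg₃, hS.reg₄, hx, hC.scanned, hxA]
    refine hQ _ _ ⟨A, sel, r, _, w - 1, k, ⟨hC.pop h.le hb hl (le_refl A) hxA ?_ ?_ ?_ ?_ ?_, h.inv, ?_, ?_,
      h.le, hnil⟩, Or.inl ⟨rfl, by simpa using h₁₁, by omega, by omega⟩⟩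
    · intro i hi
      interval_cases i <;> simp
    · intro i hi
      interval_cases i <;> simp
    · simp
    · simpa using hC.scanned
    · simp
    · simpa using h.stamp
    · simpa using h₁₀
  · simp [scanNext, scanVertex, h₁₀, hk, hS.reg₃, hS.reg₄, hx, hC.scanned, hxA]
    have hmax : ∀ z ∈ X, z ∉ A → r z ≤ r x := by
      intro z hz hzA
      have := hC.mem_bkt z hz hzA
      by_contra hlt
      rw [h.eq_nil (r z) (by omega)] at this
      simp at this
    refine WP.mono (Mid.loop (e := e) (F := F) (A := A) (sel := sel) (r := r) (w := w - 1)
      (bkt := Function.update bkt k l) (sel₀ := sel) (r₀ := r) (x := x) (Δ := Δ)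
      ⟨hC.pop h.le hb hl (Finset.subset_insert x A) (by simp) ?_ ?_ ?_ ?_ ?_, h.inv.scan hxA, ?_,
        ?_, ?_, ?_, ?_, ?_, fun _ h => h, fun _ h => h.elim⟩ hadj hF hΔ) ?_
    · intro i hi
      interval_cases i <;> simp
    · intro i hi
      interval_cases i <;> simp
    · simp
    · intro v
      by_cases hv : v = x
      · simp [hv]
      · simpa [update_val, hv] using hC.scanned v
    · simp
    · intro y
      simpa [h.inv.mult_eq_zero hxA] using h.stamp y x hxA
    · simp [h.inv.mult_eq_zero hxA]
    · intro y z hz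
      simpa using h.stamp y z fun hzA => hz (by simp [hzA])
    · simpa using h₁₁
    · simp
    · simpa using hC.adjacency x
    · rintro s' τ' ⟨sel', r', bkt', w', hM, hτ, hw'⟩
      have hS' := hM.core.static
      have hI := hM.scan.finish h.inv hxA hxb.1 hmax hF fun v hv hsel hvx y hvy hyA hyx =>
        hM.covered v ((hadj x v).2 hvx.symm) hv hsel y ((hadj v y).2 hvy) hyA hyx
      rw [wp_copy]
      refine hQ _ _ ⟨insert x A, sel', r', bkt', w', c, ⟨hM.core.congr rfl ?_, hI, hM.stamp_old, ?_, le_rfl,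
        ?_⟩, Or.inr (Or.inr ⟨x, hxb.1, hxA, rfl, ?_, rfl, by omega, ?_⟩)⟩
      · intro i hi
        interval_cases i <;> simp
      · simpa using hS'.reg₂
      -- The pointer restarts at `c` because the scan may have filled higher buckets; those above
      -- `c` stay empty because `r` never exceeds `c`.
      · intro k' hk'
        rw [List.eq_nil_iff_forall_not_mem]
        intro y hy
        have h1 := (hM.core.bkt_le k' y hy).2
        have h2 := hI.r_le y
        omega
      · simpa using hM.reg₁₁
      · omega

theorem sum_sdiff_insert {ι : Type*} [DecidableEq ι] {X A : Finset ι} {x : ι} (hx : x ∈ X)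
    (hxA : x ∉ A) (g : ι → ℕ) :
    ∑ y ∈ X \ A, g y = g x + ∑ y ∈ X \ insert x A, g y := by
  rw [← Finset.add_sum_erase (X \ A) g (by simp [hx, hxA] : x ∈ X \ A)]
  congr 2
  ext y
  simp
  tauto

/-- The potential is `w + k`, the bucket entries plus the pointer. A step without a scan costs at
most 9 with its test and lowers the potential by one, except for the final step. A scan of `x`
raises it by at most Δ deg x + c, which adds 9Δ deg x + 9c to the cost (31Δ+7) deg x + 12 of the
scan. -/
theorem Main.loop {k : ℕ} (h : Main c e F X adj A sel r bkt w k s)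
    (hadj : ∀ u z : Fin n, z ∈ adj u ↔ F.Adj u z) (hF : F.IsVertexCover (X : Set (Fin n)))
    (hΔ : ∀ v : Fin n, v ∉ X → (adj v).length ≤ Δ) (h₁₁ : s.reg 11 = 0) :
    WP (.while (.eq 11 3) scanNext) (fun s' τ' => ∃ sel' r' bkt' w' k',
      Main c e F X adj X sel' r' bkt' w' k' s' ∧
      τ' ≤ τ + 9 * (w + k) + 6 +
        ∑ x ∈ X \ A, ((40 * Δ + 7) * (adj x).length + 9 * c + 12)) s τ := by
  set g : Fin n → ℕ := fun x => (40 * Δ + 7) * (adj x).length + 9 * c + 12 with hg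
  refine wp_while (fun s' τ' => ∃ A' sel' r' bkt' w' k', Main c e F X adj A' sel' r' bkt' w' k' s' ∧
    (s'.reg 11 = 0 ∧ τ' + 9 * (w' + k') + 5 + ∑ x ∈ X \ A', g x ≤
      τ + 9 * (w + k) + 5 + ∑ x ∈ X \ A, g x ∨
    s'.reg 11 = 1 ∧ A' = X ∧ τ' ≤ τ + 9 * (w + k) + 5 + ∑ x ∈ X \ A, g x))
    (τ + 9 * (w + k) + 5 + ∑ x ∈ X \ A, g x)
    ⟨A, sel, r, bkt, w, k, h, Or.inl ⟨h₁₁, le_rfl⟩⟩ ?_ ?_ ?_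
  · rintro s' τ' ⟨_, _, _, _, _, _, -, h | h⟩ <;> omega
  · rintro s' τ' ⟨A', sel', r', bkt', w', k', h, hor⟩ hs
    rw [holds_eq, h.core.static.reg₃] at hs
    rcases hor with ⟨-, hτ⟩ | ⟨h1, -⟩
    swap
    · omega
    refine (h.step hadj hF hΔ hs).mono ?_
    rintro s₂ τ₂ ⟨A₂, sel₂, r₂, bkt₂, w₂, k₂, h₂, h₃⟩
    refine ⟨A₂, sel₂, r₂, bkt₂, w₂, k₂, h₂, ?_⟩
    rcases h₃ with ⟨rfl, h0, hwk, hτ₂⟩ | ⟨hA, -, h0, hwk, hτ₂⟩ | ⟨x, hx, hxA, rfl, h0, rfl, hwk, hτ₂⟩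
    · exact Or.inl ⟨h0, by omega⟩
    · exact Or.inr ⟨h0, hA, by omega⟩
    · refine Or.inl ⟨h0, ?_⟩
      rw [sum_sdiff_insert hx hxA] at hτ
      have hgx : g x = 9 * (Δ * (adj x).length) + (31 * Δ + 7) * (adj x).length + 9 * k₂ + 12 := by
        simp only [hg]
        ring
      omega
  · rintro s' τ' ⟨A', sel', r', bkt', w', k', h, hor⟩ hs
    rw [holds_eq, h.core.static.reg₃] at hs
    rcases hor with ⟨h0, -⟩ | ⟨-, rfl, hτ⟩
    · exact absurd h0 hs
    · refine ⟨sel', r', bkt', w', k', h, ?_⟩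
      change _ ≤ _ + ∑ x ∈ A' \ A, g x
      omega

end

section
variable {n m c : ℕ} {e : Fin m → Fin n × Fin n} {F : SimpleGraph (Fin n)}
  {X : Finset (Fin n)} {s : State} {τ : ℕ}

/-! ### Initialization and output -/

/-- The state after the vertices below `i` are initialized. -/
structure InitVertices {n m : ℕ} (c : ℕ) (e : Fin m → Fin n × Fin n) (X : Finset (Fin n)) (i : ℕ)
    (l : List (Fin n)) (s : State) : Prop where
  static : Static c e s
  reg₇ : s.reg 7 = i
  le : i ≤ n
  reg₁₁ : s.reg 11 = 0
  arr₂ : ∀ v : Fin n, s.arr 2 v = if v ∈ X then 1 else 0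
  arr₃ : ∀ v : Fin n, v < i → s.arr 3 v = if v ∈ X then 1 else 0
  arr_zero : ∀ a, a = 4 ∨ a = 7 ∨ a = 9 ∨ a = 10 ∨ a = 11 → ∀ j, s.arr a j = 0
  buckets : AreLists (s.arr 5) (s.arr 6) (s.reg 5) (s.arr 8) (Function.update (fun _ => []) 0 l)
  sub : ∀ y ∈ l, y ∈ X
  mem : ∀ y ∈ X, y < i → y ∈ l
  length_le : l.length ≤ i

theorem initVertices_spec (c : ℕ) (e : Fin m → Fin n × Fin n) (X : Finset (Fin n)) (τ : ℕ) :
    WP (.while (.lt 7 0) initVertex) (fun s' τ' => (∃ l, InitVertices c e X n l s') ∧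
      τ' ≤ τ + 10 * n + 1) ((inputState c e X).setReg 4 1) τ := by
  refine wp_while (fun s' τ' => ∃ i l, InitVertices c e X i l s' ∧ τ' ≤ τ + 10 * i) (τ + 10 * n)
    ⟨0, [], ⟨⟨rfl, rfl, rfl, rfl, rfl, ?_, ?_⟩, rfl, by omega, rfl, ?_, by simp, ?_, ?_, by simp,
      by simp, by simp⟩, le_rfl⟩ ?_ ?_ ?_
  · simp [inputState]
  · simp [inputState]
  · simp [inputState]
  · rintro a (rfl | rfl | rfl | rfl | rfl) j <;> rfl
  · intro i
    rw [Function.update_eq_self_iff.2 rfl]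
    rfl
  · rintro s' τ' ⟨i, l, h, hτ⟩
    have := h.le
    omega
  · rintro s' τ' ⟨i, l, h, hτ⟩ hs
    refine WP.of_forall fun Q hQ => ?_
    have hS := h.static
    rw [holds_lt, h.reg₇, hS.reg₀] at hs
    have h₂ := h.arr₂ ⟨i, hs⟩
    have harr₃ : ∀ v : Fin n, v < i + 1 → Function.update (s'.arr 3) i (s'.arr 2 i) v =
        if v ∈ X then 1 else 0 := by
      intro v hv
      by_cases hvi : (v : ℕ) = i
      · subst hvi
        simpa using h.arr₂ v
      · rw [Function.update_of_ne hvi]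
        exact h.arr₃ v (by omega)
    by_cases hX : (⟨i, hs⟩ : Fin n) ∈ X
    · rw [if_pos hX] at h₂
      simp only at h₂
      rw [h₂] at harr₃
      simp [initVertex, push, h.reg₇, h₂, hS.reg₄, hS.reg₃]
      have hpush := h.buckets.push 0 ⟨i, hs⟩
      rw [Function.update_idem, Function.update_self] at hpush
      refine hQ _ _ ⟨i + 1, ⟨i, hs⟩ :: l, ⟨⟨by simp [hS.reg₀], by simp [hS.reg₁], by simp [hS.reg₂],
        by simp [hS.reg₃], by simp [hS.reg₄], by simpa using hS.arr₀, by simpa using hS.arr₁⟩,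
        by simp, hs, by simp [h.reg₁₁], by simpa using h.arr₂, by simpa using harr₃, ?_,
        by simpa using hpush, ?_, ?_, ?_⟩, by omega⟩
      · intro a ha
        have := h.arr_zero a ha
        rcases ha with rfl | rfl | rfl | rfl | rfl <;> simpa using this
      · simpa [hX] using h.sub
      · intro y hy hyi
        rcases Nat.lt_succ_iff_lt_or_eq.1 hyi with hlt | heq
        · exact List.mem_cons_of_mem _ (h.mem y hy hlt)
        · simp [Fin.ext_iff, heq]
      · simpa using h.length_le
    · rw [if_neg hX] at h₂
      simp only at h₂
      rw [h₂] at harr₃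
      simp [initVertex, push, h.reg₇, h₂, hS.reg₄]
      refine hQ _ _ ⟨i + 1, l, ⟨⟨by simp [hS.reg₀], by simp [hS.reg₁], by simp [hS.reg₂],
        by simp [hS.reg₃], by simp [hS.reg₄], by simpa using hS.arr₀, by simpa using hS.arr₁⟩,
        by simp, hs, by simp [h.reg₁₁], by simpa using h.arr₂, by simpa using harr₃, ?_,
        by simpa using h.buckets, h.sub, ?_, h.length_le.trans (by omega)⟩, by omega⟩
      · intro a ha
        have := h.arr_zero a ha
        rcases ha with rfl | rfl | rfl | rfl | rfl <;> simpa using this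
      · intro y hy hyi
        rcases Nat.lt_succ_iff_lt_or_eq.1 hyi with hlt | heq
        · exact h.mem y hy hlt
        · obtain rfl : y = ⟨i, hs⟩ := Fin.ext heq
          exact absurd hy hX
  · rintro s' τ' ⟨i, l, h, hτ⟩ hs
    rw [holds_lt, h.reg₇, h.static.reg₀] at hs
    obtain rfl : i = n := by
      have := h.le
      omega
    exact ⟨⟨l, h⟩, by omega⟩

/-- The state after the first `j` edges are added to the adjacency lists. -/
structure InitEdges {n m : ℕ} (c : ℕ) (e : Fin m → Fin n × Fin n) (X : Finset (Fin n)) (j : ℕ)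
    (adj : ℕ → List (Fin n)) (bkt : ℕ → List (Fin n)) (w : ℕ) (s : State) : Prop where
  core : Core c e X adj ∅ (fun _ => none) (fun _ => 0) bkt w s
  reg₇ : s.reg 7 = j
  le : j ≤ m
  reg₁₁ : s.reg 11 = 0
  arr₁₁ : ∀ i, s.arr 11 i = 0
  mem_adj : ∀ u v : Fin n, v ∈ adj u ↔ ∃ i : Fin m, i < j ∧ s((e i).1, (e i).2) = s(u, v)
  nodup : ∀ u : Fin n, (adj u).Nodup

theorem InitVertices.initEdges {l : List (Fin n)} (h : InitVertices c e X n l s) :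
    InitEdges c e X 0 (fun _ => []) (Function.update (fun _ => []) 0 l) l.length
      (s.setReg 7 0) := by
  have hS := h.static
  refine ⟨⟨hS.congr rfl ?_, ?_, ?_, ?_, ?_, ?_, ?_, ?_, ?_, ?_⟩, by simp, by omega, ?_, ?_, by simp,
    by simp⟩
  · intro i hi
    interval_cases i <;> simp
  · intro v
    simpa using h.arr₃ v v.2
  · simpa using h.arr_zero 4 (by simp)
  · intro i
    simp [IsList, h.arr_zero 7]
  · simpa using h.buckets
  · simp [h.arr_zero 9]
  · simp [h.arr_zero 10]
  · intro k y hy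
    by_cases hk : k = 0
    · subst hk
      exact ⟨h.sub y (by simpa using hy), le_rfl⟩
    · simp [Function.update_of_ne hk] at hy
  · intro y hy _
    simpa using h.mem y hy y.2
  · rw [Finset.sum_eq_single 0]
    · simp
    · intro k _ hk
      simp [Function.update_of_ne hk]
    · simp
  · simpa using h.reg₁₁
  · simpa using h.arr_zero 11 (by simp)

theorem mem_update_adj {adj : ℕ → List (Fin n)} {a b : Fin n} (hab : a ≠ b) (u v : Fin n) :
    v ∈ Function.update (Function.update adj a (b :: adj a)) b
      (a :: Function.update adj a (b :: adj a) b) u ↔ v ∈ adj u ∨ s(a, b) = s(u, v) := by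
  have hba : (b : ℕ) ≠ a := fun h => hab (Fin.ext h.symm)
  rw [Function.update_of_ne hba]
  by_cases hub : u = b
  · subst hub
    simp only [Function.update_self, List.mem_cons, Sym2.eq_iff]
    constructor
    · rintro (rfl | h)
      · exact Or.inr (by simp)
      · exact Or.inl h
    · rintro (h | ⟨h, -⟩ | ⟨rfl, -⟩)
      · exact Or.inr h
      · exact absurd h hab
      · exact Or.inl rfl
  · rw [Function.update_of_ne fun h => hub (Fin.ext h)]
    by_cases hua : u = a
    · subst hua
      simp only [Function.update_self, List.mem_cons, Sym2.eq_iff]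
      constructor
      · rintro (rfl | h)
        · exact Or.inr (by simp)
        · exact Or.inl h
      · rintro (h | ⟨-, rfl⟩ | ⟨-, h⟩)
        · exact Or.inr h
        · exact Or.inl rfl
        · exact absurd h.symm hab
    · rw [Function.update_of_ne fun h => hua (Fin.ext h), Sym2.eq_iff]
      constructor
      · exact Or.inl
      · rintro (h | ⟨h, -⟩ | ⟨-, h⟩)
        · exact h
        · exact absurd h.symm hua
        · exact absurd h.symm hub

theorem nodup_update_adj {adj : ℕ → List (Fin n)} {a b : Fin n} (hab : a ≠ b)
    (hnd : ∀ u : Fin n, (adj u).Nodup) (ha : b ∉ adj a) (hb : a ∉ adj b) (u : Fin n) :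
    (Function.update (Function.update adj a (b :: adj a)) b
      (a :: Function.update adj a (b :: adj a) b) u).Nodup := by
  have hba : (b : ℕ) ≠ a := fun h => hab (Fin.ext h.symm)
  rw [Function.update_of_ne hba]
  by_cases hub : u = b
  · subst hub
    simpa using ⟨hb, hnd u⟩
  · rw [Function.update_of_ne fun h => hub (Fin.ext h)]
    by_cases hua : u = a
    · subst hua
      simpa using ⟨ha, hnd u⟩
    · rw [Function.update_of_ne fun h => hua (Fin.ext h)]
      exact hnd u

theorem InitEdges.step {j : ℕ} {adj bkt : ℕ → List (Fin n)} {w : ℕ} (he : IsEdgeList F e)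
    (h : InitEdges c e X j adj bkt w s) (hj : j < m) :
    WP initEdge (fun s' τ' => ∃ adj', InitEdges c e X (j + 1) adj' bkt w s' ∧ τ' ≤ τ + 13) s τ := by
  refine WP.of_forall fun Q hQ => ?_
  have hC := h.core
  have hS := hC.static
  have h₀ := hS.arr₀ ⟨j, hj⟩
  have h₁ := hS.arr₁ ⟨j, hj⟩
  set a := (e ⟨j, hj⟩).1 with ha
  set b := (e ⟨j, hj⟩).2 with hb
  have hab : a ≠ b := by
    have : s(a, b) ∈ F.edgeSet := he.2 ▸ Set.mem_range_self (⟨j, hj⟩ : Fin m)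
    exact F.ne_of_adj this
  -- Each edge is listed once, so neither end is yet in the list of the other. The adjacency lists
  -- stay free of repetitions, and their lengths are the degrees.
  have hnew : ∀ u v : Fin n, s(a, b) = s(u, v) → v ∉ adj u := by
    intro u v huv hv
    obtain ⟨i, hi, hiv⟩ := (h.mem_adj u v).1 hv
    have : i = ⟨j, hj⟩ := he.1 (hiv.trans huv.symm)
    subst this
    exact lt_irrefl _ hi
  have hl := (hC.adjacency.push a b).push b a
  have hk := (hC.buckets.frame b (s.arr 7 a)).frame a (Function.update (s.arr 7) a (s.reg 5 + 1) b)
  simp only at h₀ h₁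
  simp [initEdge, push, h.reg₇, h₀, h₁]
  refine hQ _ _ ⟨_, ⟨⟨⟨by simp [hS.reg₀], by simp [hS.reg₁], by simp [hS.reg₂],
      by simp [hS.reg₃], by simp [hS.reg₄], by simpa using hS.arr₀, by simpa using hS.arr₁⟩,
      by simpa using hC.arr₃, by simpa using hC.arr₄, by simpa using hl, by simpa using hk,
      by simpa using hC.scanned, by simpa using hC.arr₁₀, hC.bkt_le, hC.mem_bkt, hC.size⟩,
      by simp, hj, by simpa using h.reg₁₁, by simpa using h.arr₁₁, fun u v => ?_,
      nodup_update_adj hab h.nodup (hnew a b rfl) (hnew b a Sym2.eq_swap)⟩, by omega⟩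
  rw [mem_update_adj hab, h.mem_adj]
  constructor
  · rintro (⟨i, hi, hiv⟩ | huv)
    · exact ⟨i, by omega, hiv⟩
    · exact ⟨⟨j, hj⟩, by simp, huv⟩
  · rintro ⟨i, hi, hiv⟩
    rcases Nat.lt_succ_iff_lt_or_eq.1 hi with hlt | heq
    · exact Or.inl ⟨i, hlt, hiv⟩
    · obtain rfl : i = ⟨j, hj⟩ := Fin.ext heq
      exact Or.inr hiv

theorem InitEdges.loop {adj bkt : ℕ → List (Fin n)} {w : ℕ} (he : IsEdgeList F e)
    (h : InitEdges c e X 0 adj bkt w s) :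
    WP (.while (.lt 7 1) initEdge) (fun s' τ' => ∃ adj', InitEdges c e X m adj' bkt w s' ∧
      τ' ≤ τ + 14 * m + 1) s τ := by
  refine wp_while (fun s' τ' => ∃ j adj', InitEdges c e X j adj' bkt w s' ∧ τ' ≤ τ + 14 * j)
    (τ + 14 * m) ⟨0, adj, h, le_rfl⟩ ?_ ?_ ?_
  · rintro s' τ' ⟨j, adj', h, hτ⟩
    have := h.le
    omega
  · rintro s' τ' ⟨j, adj', h, hτ⟩ hs
    rw [holds_lt, h.reg₇, h.core.static.reg₁] at hs
    refine (h.step he hs).mono ?_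
    rintro s₂ τ₂ ⟨adj₂, h₂, hτ₂⟩
    exact ⟨j + 1, adj₂, h₂, by omega⟩
  · rintro s' τ' ⟨j, adj', h, hτ⟩ hs
    rw [holds_lt, h.reg₇, h.core.static.reg₁] at hs
    obtain rfl : j = m := by
      have := h.le
      omega
    exact ⟨adj', h, by omega⟩

theorem InitEdges.mem_iff {adj bkt : ℕ → List (Fin n)} {w : ℕ} (he : IsEdgeList F e)
    (h : InitEdges c e X m adj bkt w s) (u v : Fin n) : v ∈ adj u ↔ F.Adj u v := by
  rw [h.mem_adj, ← SimpleGraph.mem_edgeSet, ← he.2]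
  simp

theorem InitEdges.length_eq [DecidableRel F.Adj] {adj bkt : ℕ → List (Fin n)} {w : ℕ}
    (he : IsEdgeList F e) (h : InitEdges c e X m adj bkt w s) (u : Fin n) :
    (adj u).length = F.degree u := by
  rw [← List.toFinset_card_of_nodup (h.nodup u), ← SimpleGraph.card_neighborFinset_eq_degree]
  congr 1
  ext v
  simp [h.mem_iff he]

theorem IsEdgeList.sum_degree [DecidableRel F.Adj] (he : IsEdgeList F e) :
    ∑ v, F.degree v = 2 * m := by
  rw [F.sum_degrees_eq_twice_card_edges]
  have : F.edgeFinset = Finset.univ.image fun j => s((e j).1, (e j).2) := by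
    ext p
    rw [SimpleGraph.mem_edgeFinset, ← he.2]
    simp
  rw [this, Finset.card_image_of_injective _ he.1, Finset.card_univ, Fintype.card_fin]

theorem InitEdges.main {adj bkt : ℕ → List (Fin n)} {w : ℕ}
    (h : InitEdges c e X m adj bkt w s) :
    Main c e F X adj ∅ (fun _ => none) (fun _ => 0) bkt w c (s.setReg 10 c) := by
  refine ⟨h.core.congr rfl ?_, Inv.init F X c, ?_, by simp, le_rfl, ?_⟩
  · intro i hi
    interval_cases i <;> simp
  · simp [h.arr₁₁]
  · intro k hk
    rw [List.eq_nil_iff_forall_not_mem]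
    intro y hy
    have := (h.core.bkt_le k y hy).2
    omega

theorem outputEdges_spec {adj bkt : ℕ → List (Fin n)} {A : Finset (Fin n)}
    {sel : Fin n → Option (Fin n × Fin n)} {r : Fin n → ℕ} {w : ℕ} (he : IsEdgeList F e)
    (h : Core c e X adj A sel r bkt w s) (h₇ : s.reg 7 = 0) :
    WP (.while (.lt 7 1) outputEdge) (fun s' τ' => Outputs s' e (cover F X sel) ∧
      τ' ≤ τ + 9 * m + 1) s τ := by
  classical
  refine wp_while (fun s' τ' => ∃ j ≤ m, s'.reg 7 = j ∧ Static c e s' ∧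
    (∀ v : Fin n, s'.arr 3 v = if v ∈ (cover F X sel).verts then 1 else 0) ∧
    (∀ i : Fin m, s'.arr 4 i = if i < j ∧ s((e i).1, (e i).2) ∈ (cover F X sel).edgeSet
      then 1 else 0) ∧ τ' ≤ τ + 9 * j) (τ + 9 * m)
    ⟨0, by omega, h₇, h.static, ?_, by simp [h.arr₄], le_rfl⟩ ?_ ?_ ?_
  · intro v
    rw [h.arr₃]
    simp only [mem_cover]
  · rintro s' τ' ⟨j, hj, -, -, -, -, hτ⟩
    omega
  · rintro s' τ' ⟨j, hj, h₇, hS, h₃, h₄, hτ⟩ hs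
    refine WP.of_forall fun Q hQ => ?_
    rw [holds_lt, h₇, hS.reg₁] at hs
    have h₀ := hS.arr₀ ⟨j, hs⟩
    have h₁ := hS.arr₁ ⟨j, hs⟩
    have hedge : s((e ⟨j, hs⟩).1, (e ⟨j, hs⟩).2) ∈ (cover F X sel).edgeSet ↔
        (e ⟨j, hs⟩).1 ∈ (cover F X sel).verts ∧ (e ⟨j, hs⟩).2 ∈ (cover F X sel).verts := by
      have : s((e ⟨j, hs⟩).1, (e ⟨j, hs⟩).2) ∈ F.edgeSet :=
        he.2 ▸ Set.mem_range_self (⟨j, hs⟩ : Fin m)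
      rw [SimpleGraph.mem_edgeSet] at this
      rw [SimpleGraph.Subgraph.mem_edgeSet, cover_adj]
      tauto
    simp only at h₀ h₁
    by_cases ha : (e ⟨j, hs⟩).1 ∈ (cover F X sel).verts
    · simp [outputEdge, h₇, h₀, h₁, h₃, hS.reg₄, ha]
      refine hQ _ _ ⟨j + 1, hs, by simp, ⟨by simp [hS.reg₀], by simp [hS.reg₁], by simp [hS.reg₂],
        by simp [hS.reg₃], by simp [hS.reg₄], by simpa using hS.arr₀, by simpa using hS.arr₁⟩,
        by simpa using h₃, ?_, by omega⟩
      intro i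
      by_cases hi : (i : ℕ) = j
      · obtain rfl : i = ⟨j, hs⟩ := Fin.ext hi
        simp [hedge, ha]
      · have : (i : ℕ) < j + 1 ↔ (i : ℕ) < j := by omega
        simpa [hi, this] using h₄ i
    -- Nothing is written when the first end is missing: array 4 still holds its initial 0 there.
    · simp [outputEdge, h₇, h₀, h₁, h₃, hS.reg₄, ha]
      refine hQ _ _ ⟨j + 1, hs, by simp, ⟨by simp [hS.reg₀], by simp [hS.reg₁], by simp [hS.reg₂],
        by simp [hS.reg₃], by simp [hS.reg₄], by simpa using hS.arr₀, by simpa using hS.arr₁⟩,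
        by simpa using h₃, ?_, by omega⟩
      intro i
      by_cases hi : (i : ℕ) = j
      · obtain rfl : i = ⟨j, hs⟩ := Fin.ext hi
        simpa [hedge, ha] using h₄ ⟨j, hs⟩
      · have : (i : ℕ) < j + 1 ↔ (i : ℕ) < j := by omega
        simpa [this] using h₄ i
  · rintro s' τ' ⟨j, hj, h₇, hS, h₃, h₄, hτ⟩ hs
    rw [holds_lt, h₇, hS.reg₁] at hs
    obtain rfl : j = m := by omega
    refine ⟨⟨fun v => ?_, fun i => ?_⟩, by omega⟩
    · rw [h₃]
    · simpa using h₄ i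

/-! ### Assembly and total running time. -/

theorem algorithm_spec [DecidableRel F.Adj] {Δ : ℕ} (he : IsEdgeList F e)
    (hF : F.IsVertexCover (X : Set (Fin n))) (hΔ : ∀ v, v ∉ X → F.degree v ≤ Δ) :
    ∃ sel r s' t, Inv F X c X sel r ∧ Exec algorithm (inputState c e X) s' t ∧
      Outputs s' e (cover F X sel) ∧
      t ≤ 10 * n + 23 * m + 9 * (n + c) + 15 + ((40 * Δ + 7) * (2 * m) + (9 * c + 12) * n) := by
  have hwp : WP algorithm (fun s' t => ∃ sel r, Inv F X c X sel r ∧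
      Outputs s' e (cover F X sel) ∧
      t ≤ 10 * n + 23 * m + 9 * (n + c) + 15 + ((40 * Δ + 7) * (2 * m) + (9 * c + 12) * n))
      (inputState c e X) 0 := by
    simp only [algorithm, wp_seq, wp_const]
    refine (initVertices_spec c e X _).mono ?_
    rintro s₁ τ₁ ⟨⟨l, h₁⟩, hτ₁⟩
    rw [wp_seq, wp_const, wp_seq]
    refine (h₁.initEdges.loop he).mono ?_
    rintro s₂ τ₂ ⟨adj, h₂, hτ₂⟩
    have hmain := h₂.main (F := F)
    rw [wp_seq, wp_copy, wp_seq, h₂.core.static.reg₂]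
    refine (hmain.loop (h₂.mem_iff he) hF (fun v hv => (h₂.length_eq he v).trans_le (hΔ v hv))
      (by simpa using h₂.reg₁₁)).mono ?_
    rintro s₃ τ₃ ⟨sel, r, bkt, w, k, h₃, hτ₃⟩
    rw [wp_seq, wp_const]
    refine (outputEdges_spec he (h₃.core.congr (s' := s₃.setReg 7 0) rfl ?_) (by simp)).mono ?_
    · intro i hi
      interval_cases i <;> simp
    rintro s₄ τ₄ ⟨h₄, hτ₄⟩
    refine ⟨sel, r, h₃.inv, h₄, ?_⟩
    -- The sum over `X` is enlarged to all vertices, where the degrees add up to `2 * m`.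
    have hsum : ∑ x ∈ X \ ∅, ((40 * Δ + 7) * (adj x).length + 9 * c + 12) ≤
        (40 * Δ + 7) * (2 * m) + (9 * c + 12) * n := by
      calc _ ≤ ∑ x : Fin n, ((40 * Δ + 7) * (adj x).length + 9 * c + 12) :=
            Finset.sum_le_sum_of_subset (Finset.subset_univ _)
        _ = (40 * Δ + 7) * ∑ x, F.degree x + (9 * c + 12) * n := by
            simp only [h₂.length_eq he, add_assoc]
            rw [Finset.sum_add_distrib, ← Finset.mul_sum]
            simp [mul_comm]
        _ = _ := by rw [he.sum_degree]
    have hl := h₁.length_le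
    omega
  obtain ⟨s', t, hex, sel, r, hI, hO, ht⟩ := hwp
  rw [zero_add] at ht
  exact ⟨sel, r, s', t, hI, hex, hO, ht⟩

/-- Each term is at most a constant times the product of the three factors. These constants add up
to 150, so 200 leaves room. -/
theorem time_le {c n m Δ : ℕ} (hc : 1 ≤ c) :
    10 * n + 23 * m + 9 * (n + c) + 15 + ((40 * Δ + 7) * (2 * m) + (9 * c + 12) * n) ≤
      200 * (c * max 1 Δ * max 1 (n + m)) := by
  have hΔ : Δ ≤ max 1 Δ := le_max_right _ _
  have hΔ' : 1 ≤ max 1 Δ := le_max_left _ _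
  have hN : n + m ≤ max 1 (n + m) := le_max_right _ _
  have hN' : 1 ≤ max 1 (n + m) := le_max_left _ _
  generalize max 1 Δ = d at *
  generalize max 1 (n + m) = N at *
  have h1 : c * N ≤ c * d * N := Nat.mul_le_mul_right _ (Nat.le_mul_of_pos_right _ hΔ')
  have h2 : d * N ≤ c * d * N := Nat.mul_le_mul_right _ (Nat.le_mul_of_pos_left _ hc)
  have h3 : N ≤ d * N := Nat.le_mul_of_pos_left _ hΔ'
  have h4 : c ≤ c * N := Nat.le_mul_of_pos_right _ hN'
  have h5 : Δ * m ≤ d * N := Nat.mul_le_mul hΔ (by omega)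
  have h6 : c * n ≤ c * N := Nat.mul_le_mul_left _ (by omega)
  have h7 : (40 * Δ + 7) * (2 * m) = 80 * (Δ * m) + 14 * m := by ring
  have h8 : (9 * c + 12) * n = 9 * (c * n) + 12 * n := by ring
  omega

end
end SmallCover

theorem mainTheorem11 :
    ∃ (A : SmallCover.Cmd) (C : ℕ),
      ∀ (c n m : ℕ) (F : SimpleGraph (Fin n)) [DecidableRel F.Adj] (X S : Finset (Fin n))
        (e : Fin m → Fin n × Fin n),
        1 ≤ c → IsCompl X S → F.IsVertexCover (X : Set (Fin n)) → F.IsIndepSet (S : Set (Fin n)) →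
        SmallCover.IsEdgeList F e →
        ∃ (J : F.Subgraph) (s' : SmallCover.State) (t : ℕ),
          -- the algorithm halts with output `J`, within the claimed time
          SmallCover.Exec A (SmallCover.inputState c e X) s' t ∧
          SmallCover.Outputs s' e J ∧
          t ≤ C * (c * max 1 (S.sup fun v => F.degree v) * max 1 (n + m)) ∧
          -- the properties of `J`
          (X : Set (Fin n)) ⊆ J.verts ∧
          J.verts.ncard ≤ 2 * c ! * X.card ∧
          (∀ v, v ∉ J.verts → ∀ u w, F.Adj v u → F.Adj v w → u ≠ w →
            ∃ (hu : u ∈ J.verts) (hw : w ∈ J.verts),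
              SmallCover.JoinedBy J.coe c ⟨u, hu⟩ ⟨w, hw⟩) ∧
          (3 ≤ c → SmallCover.IsKConnected F 3 → SmallCover.IsKConnected J.coe 3) := by
  refine ⟨SmallCover.algorithm, 200, fun c n m F _ X S e hc hXS hF _ he => ?_⟩
  have hΔ : ∀ v, v ∉ X → F.degree v ≤ S.sup fun v => F.degree v := by
    intro v hv
    refine Finset.le_sup (f := fun v => F.degree v) ?_
    rw [← hXS.compl_eq]
    simpa using hv
  obtain ⟨sel, r, s', t, hI, hex, hO, ht⟩ := SmallCover.algorithm_spec (c := c) he hF hΔ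
  have hX : (X : Set (Fin n)) ⊆ (SmallCover.cover F X sel).verts :=
    fun v hv => SmallCover.mem_cover.2 (Or.inl hv)
  refine ⟨SmallCover.cover F X sel, s', t, hex, hO, ht.trans (SmallCover.time_le hc), hX, ?_, ?_,
    fun hc3 hk => hI.isKConnected_cover hF hc3 hk⟩
  · exact hI.ncard_cover_le.trans
      (Nat.mul_le_mul_right _ (SmallCover.mul_pred_add_two_le_factorial hc))
  · intro v hv u w hu hw huw
    obtain ⟨huX, hwX, hl⟩ := hI.cover_linked hF hv hu hw huw
    exact ⟨hX huX, hX hwX, hI.joinedBy huX hwX huw hl _ _⟩
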